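/- Let $m,d\in\mathbb N$ be fixed. Let $I$ and $\tilde I$ be random vectors in $\mathbb R^m$, $X$ and $\tilde X$ random vectors in $\mathbb R^d$, and $Y,\epsilon$ real random variables with $Y=X^\top\beta^*+\epsilon$ for some $\beta^*\in\mathbb R^d$. Assume that $I,X,Y,\tilde I,\tilde X$ have mean zero and finite fourth moments, and that $$\operatorname{Cov}(\tilde I,\tilde X)=\operatorname{Cov}(I,X)=:C\in\mathbb R^{m\times d},\qquad \mathbb E[\epsilon\mid I]=0,\qquad \operatorname{rank}(C)=d .$$ Let $(I_i,Y_i)_{i\ge1}$ be i.i.d. copies of $(I,Y)$ and $(\tilde I_j,\tilde X_j)_{j\ge1}$ i.i.d. copies of $(\tilde I,\tilde X)$, the two sequences being independent of each other. Let the sample sizes $n,\tilde n\to\infty$ be such that, with $N=n+\tilde n$, $\tau_n=n/N\to\tau\in(0,1)$ and $\tilde\tau_n=\tilde n/N\to\tilde\tau\in(0,1)$. Let $W_N\in\mathbb R^{m\times m}$ be random matrices that are positive definite with probability tending to one, and let $W_N\overset{p}{\to}W_0$ with $W_0$ symmetric positive definite. Put $$\hat g_N(\beta)=\frac1n\sum_{i=1}^n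 I_iY_i-\hat C\beta,\qquad \hat C=\frac1{\tilde n}\sum_{j=1}^{\tilde n}\tilde I_j\tilde X_j^\top ,$$ and let the unpaired GMM estimator $\hat\beta_N$ be a (measurable) random vector that minimizes $\beta\mapsto\hat g_N(\beta)^\top W_N\,\hat g_N(\beta)$ over $\mathbb R^d$ whenever $W_N$ is positive definite. Define $$\Omega=\tau^{-1}\operatorname{Var}(IY)+\tilde\tau^{-1}\operatorname{Var}(\tilde I\tilde X^\top\beta^*),\qquad V(W)=(C^\top WC)^{-1}C^\top W\Omega WC\,(C^\top WC)^{-1}.$$ Then: 1. $\hat\beta_N\overset{p}{\to}\beta^*$. 2. $\sqrt N(\hat\beta_N-\beta^*)\overset{d}{\to}\mathcal N(0,V(W_0))$. 3. If $\Omega$ is positive definite, then $V(W)-V(\Omega^{-1})$ is positive semidefinite for every symmetric positive definite $W$; that is, the choice $W_0=\Omega^{-1}$ minimizes the asymptotic variance. 4. If $\Omega$ is positive definite and $W_0=\Omega^{-1}$, let $\hat\beta^{(0)}$ be any consistent estimator of $\beta^*$, let $\hat\Omega=\tau_n^{-1}\hat\Omega_m+\tilde\tau_n^{-1}\hat\Omega_c$,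 where $\hat\Omega_m$ and $\hat\Omega_c$ are the empirical covariance matrices (with normalizations $1/n$ and $1/\tilde n$) of $(I_iY_i)_{i\le n}$ and $(\tilde I_j\tilde X_j^\top\hat\beta^{(0)})_{j\le\tilde n}$, and let $\hat V$ be $V(\Omega^{-1})$ with $C,\Omega$ replaced by $\hat C,\hat\Omega$. Then $$\sqrt N\,\hat V^{-1/2}(\hat\beta_N-\beta^*)\overset{d}{\to}\mathcal N(0,\mathrm{Id}_d).$$ (Matrices that are not invertible, an event whose probability tends to zero, are given the inverse $0$.) The same four conclusions hold if, in $\hat g_N$, $\hat C$, $\hat\Omega$ and $\hat V$, each of the observations $I_i,Y_i,\tilde I_j,\tilde X_j$ is replaced by its difference from its sample mean. -/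

import Mathlib

open MeasureTheory ProbabilityTheory Filter Topology Matrix

noncomputable section

namespace UnpairedIV

variable {m d : ℕ}

/-- The cross-covariance matrix `Cov(A, B)` of two random vectors. -/
def crossCov {S : Type*} [MeasurableSpace S] (μ : Measure S)
    (A : S → Fin m → ℝ) (B : S → Fin d → ℝ) : Matrix (Fin m) (Fin d) ℝ :=
  Matrix.of fun a b => cov[fun s => A s a, fun s => B s b; μ]

/-- The covariance matrix `Var(A)` of a random vector. -/
def varMatrix {S : Type*} [MeasurableSpace S] (μ : Measure S)
    (A : S → Fin m → ℝ) : Matrix (Fin m) (Fin m) ℝ :=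
  crossCov μ A A

/-- The two-sample moment variance
`Ω = τ⁻¹ Var(I Y) + τ'⁻¹ Var(I' X'ᵀ β)`, where `(I', X')` is the second system. -/
def momentVar {S : Type*} [MeasurableSpace S] (μ : Measure S) (τ τ' : ℝ)
    (I : S → Fin m → ℝ) (Y : S → ℝ) (I' : S → Fin m → ℝ) (X' : S → Fin d → ℝ)
    (β : EuclideanSpace ℝ (Fin d)) : Matrix (Fin m) (Fin m) ℝ :=
  τ⁻¹ • varMatrix μ (fun s => Y s • I s) +
    τ'⁻¹ • varMatrix μ (fun s => (X' s ⬝ᵥ β.ofLp) • I' s)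

/-- The sandwich matrix `(CᵀWC)⁻¹ CᵀWΩWC (CᵀWC)⁻¹`. -/
def sandwich (C : Matrix (Fin m) (Fin d) ℝ) (Ω W : Matrix (Fin m) (Fin m) ℝ) :
    Matrix (Fin d) (Fin d) ℝ :=
  (Cᵀ * W * C)⁻¹ * (Cᵀ * W * Ω * W * C) * (Cᵀ * W * C)⁻¹

/-- The average `n⁻¹ ∑_{i < n} v i` of the first `n` terms. -/
def avg {E : Type*} [AddCommGroup E] [Module ℝ E] (n : ℕ) (v : ℕ → E) : E :=
  (n : ℝ)⁻¹ • ∑ i ∈ Finset.range n, v i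

/-- How the observations enter the sample moments: `population` means that the (mean zero)
variables are used as they are, `sampleMean` that the sample mean is subtracted first. -/
inductive Centering where
  | population
  | sampleMean

/-- The observations, as they enter the sample moments based on a sample of size `n`. -/
def Centering.obs {E : Type*} [AddCommGroup E] [Module ℝ E] (c : Centering) (n : ℕ)
    (v : ℕ → E) : ℕ → E :=
  match c with
  | .population => v
  | .sampleMean => fun i => v i - avg n v

/-- `n⁻¹ ∑ I_i Y_i`. -/
def momentIY (n : ℕ) (I : ℕ → Fin m → ℝ) (Y : ℕ → ℝ) : Fin m → ℝ :=
  avg n fun i => Y i • I i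

/-- `n⁻¹ ∑ I_j X_jᵀ`. -/
def momentIX (n : ℕ) (I : ℕ → Fin m → ℝ) (X : ℕ → Fin d → ℝ) : Matrix (Fin m) (Fin d) ℝ :=
  avg n fun j => vecMulVec (I j) (X j)

/-- The sample moment `g(β) = n⁻¹ ∑ I_i Y_i - (n'⁻¹ ∑ I'_j X'_jᵀ) β`. -/
def sampleMoment (n n' : ℕ) (I : ℕ → Fin m → ℝ) (Y : ℕ → ℝ)
    (I' : ℕ → Fin m → ℝ) (X' : ℕ → Fin d → ℝ) (β : EuclideanSpace ℝ (Fin d)) : Fin m → ℝ :=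
  momentIY n I Y - momentIX n' I' X' *ᵥ β.ofLp

/-- `β` minimizes the criterion `b ↦ g(b)ᵀ W g(b)` over `ℝᵈ`. -/
def IsGMM (W : Matrix (Fin m) (Fin m) ℝ) (n n' : ℕ) (I : ℕ → Fin m → ℝ) (Y : ℕ → ℝ)
    (I' : ℕ → Fin m → ℝ) (X' : ℕ → Fin d → ℝ) (β : EuclideanSpace ℝ (Fin d)) : Prop :=
  IsMinOn (fun b => sampleMoment n n' I Y I' X' b ⬝ᵥ W *ᵥ sampleMoment n n' I Y I' X' b)
    Set.univ β

/-- The empirical covariance matrix of `v 0, …, v (n - 1)`, with normalization `n⁻¹`. -/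
def empVar (n : ℕ) (v : ℕ → Fin m → ℝ) : Matrix (Fin m) (Fin m) ℝ :=
  avg n fun i => vecMulVec (v i - avg n v) (v i - avg n v)

/-- The estimator of `Ω` at a preliminary estimate `β₀`, with
`n / N` and `n' / N`, `N = n + n'`, in place of `τ` and `τ'`. -/
def momentVarHat (n n' : ℕ) (I : ℕ → Fin m → ℝ) (Y : ℕ → ℝ)
    (I' : ℕ → Fin m → ℝ) (X' : ℕ → Fin d → ℝ) (β₀ : EuclideanSpace ℝ (Fin d)) :
    Matrix (Fin m) (Fin m) ℝ :=
  ((n : ℝ) / ((n : ℝ) + n'))⁻¹ • empVar n (fun i => Y i • I i) +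
    ((n' : ℝ) / ((n : ℝ) + n'))⁻¹ • empVar n' (fun j => (X' j ⬝ᵥ β₀.ofLp) • I' j)

/-- The empirical version of `V(Ω⁻¹)`. -/
def asymVarHat (n n' : ℕ) (I : ℕ → Fin m → ℝ) (Y : ℕ → ℝ)
    (I' : ℕ → Fin m → ℝ) (X' : ℕ → Fin d → ℝ) (β₀ : EuclideanSpace ℝ (Fin d)) :
    Matrix (Fin d) (Fin d) ℝ :=
  sandwich (momentIX n' I' X') (momentVarHat n n' I Y I' X' β₀)
    (momentVarHat n n' I Y I' X' β₀)⁻¹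

/-- `A ^ (-1/2)` for a symmetric positive definite matrix, by functional calculus. -/
def invSqrt (A : Matrix (Fin d) (Fin d) ℝ) : Matrix (Fin d) (Fin d) ℝ :=
  cfc (fun x : ℝ => (√x)⁻¹) A

end UnpairedIV

end

/-! The criterion is a quadratic form in an affine function of `β`. Where `W` is positive definite
and `ĈᵀWĈ` is invertible, its minimizer is therefore the weighted least squares solution, and `β̂ -
β* = (ĈᵀWĈ)⁻¹ĈᵀW ĝ(β*)` (`IsGMM.sub_eq`). Since `Ĉ → C`, `W → W₀` and `C` has full column rank, this
happens with probability tending to one, and everything reduces to the single random vector `ĝ(β*)`.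

This vector is a difference of two independent sample means. Exogeneity and the equality of the
cross-covariances give both the same expectation `E[IY] = Cβ*`. The law of large numbers yields
`ĝ(β*) → 0`, hence consistency. For normality, the characteristic function of the difference
factorizes, and each factor is handled by the one-dimensional central limit theorem
(`tendstoInDistribution_two_sample`); the ratios `N/n` and `N/ñ` produce the weights in `Ω`.
Slutsky's theorem (`tendstoInDistribution_mulVec`) then gives the sandwich covariance. Centering by
sample means changes `√N ĝ(β*)` only by terms `√N · mean · mean`, which vanish in probability
(`tendsto_inProb_mul_avg_mul_avg`).

Optimality of `Ω⁻¹` is a Gauss–Markov argument: two left inverses of `C` are compared, and the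
difference of the variances is a congruence of `Ω`. For studentization, `Ω̂` is a polynomial in the
preliminary estimator whose coefficients are convergent sample moments, and `A ↦ A^(-1/2)` is
continuous on positive definite matrices and measurable everywhere.

Convergence in probability to a constant is expressed as convergence along the filter `inProb`, so
that the ordinary rules for limits and "eventually" apply to it. -/

noncomputable section

namespace UnpairedIV

/-! ### Continuity of the functional calculus of symmetric matrices -/

section FunctionalCalculus
open scoped Matrix.Norms.L2Operator

variable {d : ℕ}

/-- With respect to the operator norm, the functional calculus of real symmetric matrices is
isometric. -/
theorem isometricCFC : IsometricContinuousFunctionalCalculus ℝ (Matrix (Fin d) (Fin d) ℝ)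
    IsSelfAdjoint where
  isometric A hA := by
    refine AddMonoidHomClass.isometry_of_norm _ fun f => ?_
    have hA' : A.IsHermitian := hA
    have h1 : cfcHom hA f = hA'.cfcAux f := by rw [← hA'.cfcHom_eq_cfcAux]
    rw [h1, Matrix.IsHermitian.cfcAux_apply,
      Unitary.conjStarAlgAut_apply]
    -- Conjugation by a unitary preserves the operator norm, and the norm of a diagonal matrix is
    -- the largest absolute value of an entry; the eigenvalues exhaust the spectrum, so this is the
    -- sup norm of `f`.
    have h2 : ∀ (U : unitaryGroup (Fin d) ℝ) (D : Matrix (Fin d) (Fin d) ℝ),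
        ‖(U : Matrix (Fin d) (Fin d) ℝ) * D * star (U : Matrix (Fin d) (Fin d) ℝ)‖ = ‖D‖ := by
      intro U D
      rw [← Unitary.coe_star, CStarRing.norm_mul_coe_unitary, CStarRing.norm_coe_unitary_mul]
    rw [h2, Matrix.l2_opNorm_diagonal]
    refine le_antisymm ?_ ?_
    · rw [pi_norm_le_iff_of_nonneg (norm_nonneg _)]
      intro i
      exact f.norm_coe_le_norm _
    · rw [ContinuousMap.norm_le _ (norm_nonneg _)]
      rintro ⟨x, hx⟩
      obtain ⟨i, rfl⟩ := hA'.spectrum_real_eq_range_eigenvalues ▸ hx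
      exact norm_le_pi_norm (RCLike.ofReal ∘ f ∘ fun i ↦
        (⟨hA'.eigenvalues i, hA'.eigenvalues_mem_spectrum_real i⟩ : spectrum ℝ A)) i

theorem continuousOn_cfc_isHermitian {f : ℝ → ℝ} (hf : Continuous f) :
    ContinuousOn (fun A : Matrix (Fin d) (Fin d) ℝ => cfc f A) {A | A.IsHermitian} := by
  have := isometricCFC (d := d)
  exact continuousOn_id.cfc_of_mem_nhdsSet f univ_mem (fun A hA => hA) hf.continuousOn

/-- The function `(√x)⁻¹` is continuous only on the open half-line `(0, ∞)`, which is a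
neighbourhood of the spectrum of every positive definite matrix. -/
theorem continuousOn_invSqrt :
    ContinuousOn (invSqrt (d := d)) {A | A.PosDef} := by
  have := isometricCFC (d := d)
  refine ContinuousOn.cfc_of_mem_nhdsSet (s := Set.Ioi (0 : ℝ)) _ ?_ continuousOn_id
    (fun A hA => hA.1) ?_
  · rw [isOpen_Ioi.mem_nhdsSet]
    simp only [Set.iUnion_subset_iff]
    intro A hA x hx
    obtain ⟨i, rfl⟩ := hA.1.spectrum_real_eq_range_eigenvalues ▸ hx
    exact hA.eigenvalues_pos i
  · intro x hx
    have : √x ≠ 0 := (Real.sqrt_pos.2 hx).ne'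
    exact (Real.continuous_sqrt.continuousAt.inv₀ this).continuousWithinAt

/-- In a fixed eigenbasis only finitely many eigenvalues matter, so pointwise convergence of the
functions suffices. -/
theorem tendsto_cfc_of_isHermitian {A : Matrix (Fin d) (Fin d) ℝ} (hA : A.IsHermitian)
    {F : ℕ → ℝ → ℝ} {f : ℝ → ℝ} (h : ∀ x, Tendsto (fun k => F k x) atTop (𝓝 (f x))) :
    Tendsto (fun k => cfc (F k) A) atTop (𝓝 (cfc f A)) := by
  simp_rw [hA.cfc_eq, Matrix.IsHermitian.cfc, Unitary.conjStarAlgAut_apply]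
  refine (tendsto_const_nhds.mul ?_).mul tendsto_const_nhds
  refine (continuous_id.matrix_diagonal.tendsto _).comp (tendsto_pi_nhds.2 fun i => h _)

end FunctionalCalculus

/-! ### Borel measurability of inversion, positive definiteness and the inverse square root -/

section Measurability

variable {p q r : ℕ}

scoped instance : MeasurableSpace (Matrix (Fin p) (Fin q) ℝ) :=
  inferInstanceAs (MeasurableSpace (Fin p → Fin q → ℝ))
scoped instance : BorelSpace (Matrix (Fin p) (Fin q) ℝ) :=
  inferInstanceAs (BorelSpace (Fin p → Fin q → ℝ))
scoped instance : SecondCountableTopology (Matrix (Fin p) (Fin q) ℝ) :=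
  inferInstanceAs (SecondCountableTopology (Fin p → Fin q → ℝ))
scoped instance : TopologicalSpace.PseudoMetrizableSpace (Matrix (Fin p) (Fin q) ℝ) :=
  inferInstanceAs (TopologicalSpace.PseudoMetrizableSpace (Fin p → Fin q → ℝ))

/-- Cramer's rule with `0⁻¹ = 0` also covers singular matrices, whose inverse is `0` by convention.
-/
theorem measurable_matrix_inv :
    Measurable (fun A : Matrix (Fin p) (Fin p) ℝ => A⁻¹) := by
  simp_rw [Matrix.inv_def, Ring.inverse_eq_inv']
  have h1 : Measurable (fun A : Matrix (Fin p) (Fin p) ℝ => A.det) :=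
    (continuous_id.matrix_det).measurable
  have h2 : Measurable (fun A : Matrix (Fin p) (Fin p) ℝ => A.adjugate) :=
    (continuous_id.matrix_adjugate).measurable
  exact h1.inv.smul h2

theorem measurableSet_isHermitian : MeasurableSet {A : Matrix (Fin p) (Fin p) ℝ | A.IsHermitian} :=
  (isClosed_eq (continuous_id.matrix_conjTranspose) continuous_id).measurableSet

theorem measurableSet_posDef : MeasurableSet {A : Matrix (Fin p) (Fin p) ℝ | A.PosDef} := by
  -- The positive semidefinite cone is closed, and inside it positive definiteness is the open
  -- condition of a nonzero determinant.
  have : {A : Matrix (Fin p) (Fin p) ℝ | A.PosDef} =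
      ({A | A.IsHermitian} ∩ ⋂ x : Fin p → ℝ, {A | 0 ≤ star x ⬝ᵥ (A *ᵥ x)}) ∩
        {A | A.det ≠ 0} := by
    ext A
    simp only [Set.mem_ofPred_eq, Set.mem_inter_iff, Set.mem_iInter]
    rw [← posSemidef_iff_dotProduct_mulVec]
    exact ⟨fun h => ⟨h.posSemidef, h.det_pos.ne'⟩, fun h => h.1.posDef_iff_det_ne_zero.2 h.2⟩
  rw [this]
  refine (measurableSet_isHermitian.inter (IsClosed.measurableSet ?_)).inter
    (IsOpen.measurableSet ?_)
  · exact isClosed_iInter fun x => isClosed_le continuous_const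
      (continuous_const.dotProduct (continuous_id.matrix_mulVec continuous_const))
  · exact isOpen_ne_fun continuous_id.matrix_det continuous_const

/-- Measurability is needed on all matrices, since the estimated variance may fail to be positive
definite. The globally continuous functions `√x / (max x 0 + 1/(k+1))` converge at every real `x` to
`(√x)⁻¹`, both being `0` for `x ≤ 0`; off the symmetric matrices the functional calculus is `0` by
definition. -/
theorem measurable_invSqrt : Measurable (invSqrt (d := p)) := by
  have key : ∀ k : ℕ, Measurable (fun A : Matrix (Fin p) (Fin p) ℝ =>
      cfc (fun x : ℝ => √x / (max x 0 + (k + 1 : ℝ)⁻¹)) A) := by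
    intro k
    have hc : Continuous (fun x : ℝ => √x / (max x 0 + (k + 1 : ℝ)⁻¹)) := by
      refine Real.continuous_sqrt.div (by fun_prop) fun x => ?_
      positivity
    have h1 := continuousOn_cfc_isHermitian (d := p) hc
    have : (fun A : Matrix (Fin p) (Fin p) ℝ =>
      cfc (fun x : ℝ => √x / (max x 0 + (k + 1 : ℝ)⁻¹)) A) =
        Set.indicator {A | A.IsHermitian} (fun A : Matrix (Fin p) (Fin p) ℝ =>
      cfc (fun x : ℝ => √x / (max x 0 + (k + 1 : ℝ)⁻¹)) A) := by
      ext1 A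
      by_cases hA : A.IsHermitian
      · rw [Set.indicator_of_mem (by exact hA)]
      · rw [Set.indicator_of_notMem (by exact hA)]
        exact cfc_apply_of_not_predicate A hA
    rw [this, ← Set.piecewise_eq_indicator]
    exact h1.measurable_piecewise continuousOn_const measurableSet_isHermitian
  refine measurable_of_tendsto_metrizable key (tendsto_pi_nhds.2 fun A => ?_)
  by_cases hA : A.IsHermitian
  · refine tendsto_cfc_of_isHermitian hA fun x => ?_
    rcases le_or_gt x 0 with hx | hx
    · simp [Real.sqrt_eq_zero_of_nonpos hx]
    · have h2 : (√x)⁻¹ = √x / (max x 0 + 0) := by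
        rw [max_eq_left hx.le, add_zero, Real.sqrt_div_self']
        simp
      rw [h2]
      refine tendsto_const_nhds.div (tendsto_const_nhds.add ?_) ?_
      · simpa using tendsto_one_div_add_atTop_nhds_zero_nat (𝕜 := ℝ)
      · rw [max_eq_left hx.le, add_zero]; exact hx.ne'
  · have h3 : invSqrt A = 0 := cfc_apply_of_not_predicate A hA
    rw [h3]
    refine tendsto_const_nhds.congr fun k => (cfc_apply_of_not_predicate A hA).symm

end Measurability

/-! ### Least squares algebra: the explicit minimizer and the optimal weight -/

section Algebra
variable {m d : ℕ}

/-- The matrix `(CᵀWC)⁻¹CᵀW`, which maps the sample moment at `β` to the estimation error. -/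
def gmmMatrix (C : Matrix (Fin m) (Fin d) ℝ) (W : Matrix (Fin m) (Fin m) ℝ) :
    Matrix (Fin d) (Fin m) ℝ :=
  (Cᵀ * W * C)⁻¹ * (Cᵀ * W)

theorem mulVec_injective_of_rank {C : Matrix (Fin m) (Fin d) ℝ} (h : C.rank = d) :
    Function.Injective C.mulVec := by
  rw [Matrix.mulVec_injective_iff, linearIndependent_iff_card_eq_finrank_span, Set.finrank,
    ← Matrix.rank_eq_finrank_span_cols, h, Fintype.card_fin]

theorem posDef_gram {C : Matrix (Fin m) (Fin d) ℝ} {W : Matrix (Fin m) (Fin m) ℝ}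
    (hC : Function.Injective C.mulVec) (hW : W.PosDef) : (Cᵀ * W * C).PosDef := by
  simpa using hW.conjTranspose_mul_mul_same hC

/-- Meant for the random `Ĉ`, whose rank is not known: a nonzero determinant is an open condition
and passes from the limit to the sample. -/
theorem posDef_gram_of_det_ne_zero {C : Matrix (Fin m) (Fin d) ℝ} {W : Matrix (Fin m) (Fin m) ℝ}
    (hW : W.PosDef) (h : (Cᵀ * W * C).det ≠ 0) : (Cᵀ * W * C).PosDef := by
  have : (Cᵀ * W * C).PosSemidef := by
    simpa using hW.posSemidef.conjTranspose_mul_mul_same C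
  exact this.posDef_iff_det_ne_zero.2 h

theorem PosDef.transpose_eq {p : ℕ} {W : Matrix (Fin p) (Fin p) ℝ} (hW : W.PosDef) : Wᵀ = W := by
  simpa using hW.1.eq

/-- The right-hand side is the covariance of the image under `gmmMatrix C W` of a vector with
covariance `Ω`. -/
theorem sandwich_eq {C : Matrix (Fin m) (Fin d) ℝ} {Ω W : Matrix (Fin m) (Fin m) ℝ}
    (hW : Wᵀ = W) : sandwich C Ω W = gmmMatrix C W * Ω * (gmmMatrix C W)ᵀ := by
  simp only [sandwich, gmmMatrix, transpose_mul, transpose_transpose, transpose_nonsing_inv, hW,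
    Matrix.mul_assoc]

theorem gmmMatrix_mul {C : Matrix (Fin m) (Fin d) ℝ} {W : Matrix (Fin m) (Fin m) ℝ}
    (h : (Cᵀ * W * C).det ≠ 0) : gmmMatrix C W * C = 1 := by
  rw [gmmMatrix, Matrix.mul_assoc, nonsing_inv_mul _ (isUnit_iff_ne_zero.2 h)]

theorem sandwich_inv {C : Matrix (Fin m) (Fin d) ℝ} {Ω : Matrix (Fin m) (Fin m) ℝ}
    (hΩ : Ω.det ≠ 0) (h : (Cᵀ * Ω⁻¹ * C).det ≠ 0) :
    sandwich C Ω Ω⁻¹ = (Cᵀ * Ω⁻¹ * C)⁻¹ := by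
  rw [sandwich, Matrix.mul_assoc Cᵀ Ω⁻¹ Ω, nonsing_inv_mul _ (isUnit_iff_ne_zero.2 hΩ),
    Matrix.mul_one, nonsing_inv_mul _ (isUnit_iff_ne_zero.2 h), Matrix.one_mul]

theorem posDef_sandwich_inv {C : Matrix (Fin m) (Fin d) ℝ} {Ω : Matrix (Fin m) (Fin m) ℝ}
    (hΩ : Ω.PosDef) (h : (Cᵀ * Ω⁻¹ * C).det ≠ 0) : (sandwich C Ω Ω⁻¹).PosDef := by
  rw [sandwich_inv hΩ.det_pos.ne' h]
  exact (posDef_gram_of_det_ne_zero hΩ.inv h).inv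

/-- The weight `Ω⁻¹` minimizes the sandwich matrix in the Loewner order. -/
theorem posSemidef_sandwich_sub {C : Matrix (Fin m) (Fin d) ℝ} {Ω W : Matrix (Fin m) (Fin m) ℝ}
    (hC : C.rank = d) (hΩ : Ω.PosDef) (hW : W.PosDef) :
    (sandwich C Ω W - sandwich C Ω Ω⁻¹).PosSemidef := by
  have hC' := mulVec_injective_of_rank hC
  have h1 := (posDef_gram hC' hW).det_pos.ne'
  have h2' := posDef_gram hC' hΩ.inv
  have h2 := h2'.det_pos.ne'
  have e1 := gmmMatrix_mul h1
  have e2 : Cᵀ * (gmmMatrix C W)ᵀ = 1 := by rw [← transpose_mul, e1, transpose_one]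
  set M := gmmMatrix C W with hM
  set V := (Cᵀ * Ω⁻¹ * C)⁻¹ with hV
  have hVt : Vᵀ = V := PosDef.transpose_eq h2'.inv
  have hΩt : Ω⁻¹ᵀ = Ω⁻¹ := PosDef.transpose_eq hΩ.inv
  have u1 : Ω * Ω⁻¹ = 1 := mul_nonsing_inv _ (isUnit_iff_ne_zero.2 hΩ.det_pos.ne')
  have u2 : Ω⁻¹ * Ω = 1 := nonsing_inv_mul _ (isUnit_iff_ne_zero.2 hΩ.det_pos.ne')
  have u3 : V * (Cᵀ * Ω⁻¹ * C) = 1 := nonsing_inv_mul _ (isUnit_iff_ne_zero.2 h2)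
  -- Gauss–Markov: `M` and `V * Cᵀ * Ω⁻¹` are both left inverses of `C`. Hence the two cross terms
  -- and the last square in the expansion all equal `V`, and `M * Ω * Mᵀ - V` remains.
  have key : sandwich C Ω W - sandwich C Ω Ω⁻¹ =
      (M - V * Cᵀ * Ω⁻¹) * Ω * (M - V * Cᵀ * Ω⁻¹)ᵀ := by
    rw [sandwich_eq (PosDef.transpose_eq hW), ← hM,
      sandwich_inv hΩ.det_pos.ne' h2, ← hV]
    have a1 : (M - V * Cᵀ * Ω⁻¹) * Ω = M * Ω - V * Cᵀ := by
      rw [Matrix.sub_mul, Matrix.mul_assoc _ Ω⁻¹ Ω, u2, Matrix.mul_one]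
    have a2 : (M - V * Cᵀ * Ω⁻¹)ᵀ = Mᵀ - Ω⁻¹ * C * V := by
      rw [transpose_sub, transpose_mul, transpose_mul, transpose_transpose, hVt, hΩt,
        Matrix.mul_assoc]
    have a3 : M * Ω * (Ω⁻¹ * C * V) = V := by
      calc M * Ω * (Ω⁻¹ * C * V) = M * (Ω * Ω⁻¹) * C * V := by simp only [Matrix.mul_assoc]
        _ = V := by rw [u1, Matrix.mul_one, e1, Matrix.one_mul]
    have a4 : V * Cᵀ * Mᵀ = V := by rw [Matrix.mul_assoc, e2, Matrix.mul_one]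
    have a5 : V * Cᵀ * (Ω⁻¹ * C * V) = V := by
      calc V * Cᵀ * (Ω⁻¹ * C * V) = V * (Cᵀ * Ω⁻¹ * C) * V := by simp only [Matrix.mul_assoc]
        _ = V := by rw [u3, Matrix.one_mul]
    rw [a1, a2, Matrix.sub_mul, Matrix.mul_sub, Matrix.mul_sub, a3, a4, a5]
    abel
  rw [key]
  simpa using hΩ.posSemidef.mul_mul_conjTranspose_same (M - V * Cᵀ * Ω⁻¹)

/-- A minimizer of the criterion is an explicit function of the sample moment at any `β`. -/
theorem IsGMM.sub_eq {W : Matrix (Fin m) (Fin m) ℝ} {n n' : ℕ} {I : ℕ → Fin m → ℝ} {Y : ℕ → ℝ}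
    {I' : ℕ → Fin m → ℝ} {X' : ℕ → Fin d → ℝ} {b : EuclideanSpace ℝ (Fin d)}
    (hb : IsGMM W n n' I Y I' X' b) (hW : W.PosDef)
    (hdet : ((momentIX n' I' X')ᵀ * W * momentIX n' I' X').det ≠ 0)
    (β : EuclideanSpace ℝ (Fin d)) :
    (b - β).ofLp = gmmMatrix (momentIX n' I' X') W *ᵥ sampleMoment n n' I Y I' X' β := by
  set C := momentIX n' I' X' with hC
  set g := sampleMoment n n' I Y I' X' β with hg
  -- `β + v` is the least squares solution, and `u` is the deviation of the given minimizer from it.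
  set v : Fin d → ℝ := gmmMatrix C W *ᵥ g with hv
  set u : Fin d → ℝ := (b - β).ofLp - v with hu
  have hWt := PosDef.transpose_eq hW
  have hGram := posDef_gram_of_det_ne_zero hW hdet
  have e0 : ∀ w : Fin d → ℝ, sampleMoment n n' I Y I' X' (β + WithLp.toLp 2 w) = g - C *ᵥ w := by
    intro w
    simp only [hg, sampleMoment, WithLp.ofLp_add, mulVec_add, ← hC]
    abel
  set r := g - C *ᵥ v with hr
  -- The normal equations: the residual `r` is `W`-orthogonal to the range of `C`, so the cross
  -- terms `c1` and `c2` below vanish.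
  have normal : Cᵀ *ᵥ (W *ᵥ r) = 0 := by
    rw [hr, mulVec_sub, mulVec_sub, hv, gmmMatrix, mulVec_mulVec, mulVec_mulVec, mulVec_mulVec,
      mulVec_mulVec, sub_eq_zero]
    congr 1
    calc Cᵀ * W = (Cᵀ * W * C) * (Cᵀ * W * C)⁻¹ * (Cᵀ * W) := by
          rw [mul_nonsing_inv _ (isUnit_iff_ne_zero.2 hdet), Matrix.one_mul]
      _ = _ := by simp only [Matrix.mul_assoc]
  have hmin := hb (Set.mem_univ (β + WithLp.toLp 2 v))
  simp only [Set.mem_ofPred_eq] at hmin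
  have eb : b = β + WithLp.toLp 2 (v + u) := by
    ext i; simp [hu]
  rw [e0, ← hr] at hmin
  rw [eb, e0, mulVec_add, ← sub_sub, ← hr] at hmin
  have c1 : (C *ᵥ u) ⬝ᵥ (W *ᵥ r) = 0 := by
    rw [dotProduct_comm, dotProduct_mulVec, ← mulVec_transpose, normal, zero_dotProduct]
  have c2 : r ⬝ᵥ (W *ᵥ (C *ᵥ u)) = 0 := by
    rw [dotProduct_mulVec, ← mulVec_transpose, hWt, dotProduct_comm, c1]
  have c3 : (C *ᵥ u) ⬝ᵥ (W *ᵥ (C *ᵥ u)) = u ⬝ᵥ ((Cᵀ * W * C) *ᵥ u) := by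
    rw [← mulVec_mulVec, ← mulVec_mulVec, dotProduct_mulVec u, vecMul_transpose]
  -- By Pythagoras, minimality becomes `rᵀWr + uᵀ(CᵀWC)u ≤ rᵀWr`, which forces `u = 0`.
  rw [mulVec_sub W r (C *ᵥ u), sub_dotProduct, dotProduct_sub, dotProduct_sub, c1, c2, c3] at hmin
  by_contra hne
  have hu0 : u ≠ 0 := fun h => hne (by rw [hu, sub_eq_zero] at h; exact h)
  have := hGram.dotProduct_mulVec_pos hu0
  simp only [star_trivial] at this
  linarith

/-- On the positive spectrum this is `x^(-1/2) · x · x^(-1/2) = 1`. The transpose, harmless by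
symmetry, matches the covariance `M * A * Mᵀ` of a linear image. -/
theorem invSqrt_mul_mul_invSqrt {A : Matrix (Fin d) (Fin d) ℝ} (hA : A.PosDef) :
    invSqrt A * A * (invSqrt A)ᵀ = 1 := by
  have hsa : IsSelfAdjoint A := hA.1
  have hpos : ∀ x ∈ spectrum ℝ A, 0 < x := by
    intro x hx
    obtain ⟨i, rfl⟩ := hA.1.spectrum_real_eq_range_eigenvalues ▸ hx
    exact hA.eigenvalues_pos i
  have hfin : (spectrum ℝ A).Finite := by
    rw [hA.1.spectrum_real_eq_range_eigenvalues]; exact Set.finite_range _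
  -- Every function is continuous on a finite set, so the multiplicativity of the calculus applies
  -- to `(√x)⁻¹` as well.
  have hc : ∀ f : ℝ → ℝ, ContinuousOn f (spectrum ℝ A) := fun f => hfin.continuousOn f
  have ht : (invSqrt A)ᵀ = invSqrt A := by
    have : IsSelfAdjoint (invSqrt A) := cfc_predicate _ _
    rw [← conjTranspose_eq_transpose_of_trivial]
    exact this.star_eq
  rw [ht, invSqrt]
  nth_rewrite 2 [← cfc_id ℝ A]
  rw [← cfc_mul _ _ A (hc _) (hc _), ← cfc_mul _ _ A (hc _) (hc _)]
  rw [← cfc_one ℝ A]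
  refine cfc_congr fun x hx => ?_
  have h0 := hpos x hx
  have h1 : √x ≠ 0 := (Real.sqrt_pos.2 h0).ne'
  have h2 := Real.mul_self_sqrt h0.le
  simp only [id, Pi.one_apply]
  field_simp
  nlinarith

end Algebra

/-! ### Convergence in probability as convergence along a filter; Slutsky-type tools -/

section InProb
variable {Ω : Type*} [MeasurableSpace Ω]

/-- The filter of events `(A k)` whose probability tends to one: convergence in probability to
a constant is convergence along this filter. -/
def inProb (P : Measure Ω) : Filter (ℕ × Ω) where
  sets := {A | Tendsto (fun k => P {ω | (k, ω) ∉ A}) atTop (𝓝 0)}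
  univ_sets := by simp
  sets_of_superset {A B} hA hAB := by
    refine tendsto_of_tendsto_of_tendsto_of_le_of_le tendsto_const_nhds hA
      (fun _ => zero_le) fun k => measure_mono fun ω hω h => hω (hAB h)
  inter_sets {A B} hA hB := by
    have h := Tendsto.add (show Tendsto (fun k => P {ω | (k, ω) ∉ A}) atTop (𝓝 0) from hA)
      (show Tendsto (fun k => P {ω | (k, ω) ∉ B}) atTop (𝓝 0) from hB)
    rw [add_zero] at h
    refine tendsto_of_tendsto_of_tendsto_of_le_of_le tendsto_const_nhds h
      (fun _ => zero_le) fun k => (measure_mono fun ω hω => ?_).trans (measure_union_le _ _)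
    by_contra hc
    simp only [Set.mem_union, Set.mem_ofPred_eq, not_or, not_not] at hc
    exact hω hc

variable {P : Measure Ω}

theorem eventually_inProb {Q : ℕ × Ω → Prop} :
    (∀ᶠ p in inProb P, Q p) ↔ Tendsto (fun k => P {ω | ¬ Q (k, ω)}) atTop (𝓝 0) := Iff.rfl

theorem tendstoInMeasure_const_iff {E : Type*} [PseudoEMetricSpace E] {f : ℕ → Ω → E} {c : E} :
    TendstoInMeasure P f atTop (fun _ => c) ↔
      Tendsto (fun p : ℕ × Ω => f p.1 p.2) (inProb P) (𝓝 c) := by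
  rw [Metric.nhds_basis_eball.tendsto_right_iff]
  simp only [TendstoInMeasure, eventually_inProb, Metric.mem_eball, not_lt]

theorem tendsto_fst_inProb : Tendsto Prod.fst (inProb P) atTop := by
  intro A hA
  refine eventually_inProb.2 (tendsto_const_nhds.congr' ?_)
  filter_upwards [hA] with k hk
  rw [eq_comm]
  convert! measure_empty (μ := P)
  ext ω
  simpa using hk

theorem eventually_inProb_of_ae {Q : ℕ → Ω → Prop} (h : ∀ k, ∀ᵐ ω ∂P, Q k ω) :
    ∀ᶠ p in inProb P, Q p.1 p.2 :=
  eventually_inProb.2 (tendsto_const_nhds.congr fun k => (ae_iff.1 (h k)).symm)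

theorem tendsto_inProb_of_ae [IsFiniteMeasure P] {f : ℕ → Ω → ℝ} {c : ℝ}
    (hf : ∀ k, AEMeasurable (f k) P)
    (h : ∀ᵐ ω ∂P, Tendsto (fun k => f k ω) atTop (𝓝 c)) :
    Tendsto (fun p : ℕ × Ω => f p.1 p.2) (inProb P) (𝓝 c) :=
  tendstoInMeasure_const_iff.1
    (tendstoInMeasure_of_tendsto_ae (fun k => (hf k).aestronglyMeasurable) h)

theorem eventually_inProb_of_tendsto_one [IsProbabilityMeasure P] {s : ℕ → Set Ω}
    (hs : ∀ k, NullMeasurableSet (s k) P) (h : Tendsto (fun k => P (s k)) atTop (𝓝 1)) :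
    ∀ᶠ p in inProb P, p.2 ∈ s p.1 := by
  refine eventually_inProb.2 ?_
  have h1 := ENNReal.Tendsto.sub (tendsto_const_nhds (x := (1 : ENNReal))) h (Or.inl (by simp))
  rw [tsub_self] at h1
  exact h1.congr fun k => (prob_compl_eq_one_sub₀ (hs k)).symm

variable [IsProbabilityMeasure P] {Ω' : Type*} [MeasurableSpace Ω'] {ν : Measure Ω'}
  [IsProbabilityMeasure ν]

/-- Convergence in distribution to a constant implies convergence in probability. -/
theorem tendstoInMeasure_of_tendstoInDistribution_const {E : Type*} [PseudoEMetricSpace E]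
    [MeasurableSpace E] [BorelSpace E] {X : ℕ → Ω → E} {c : E}
    (h : TendstoInDistribution X atTop (fun _ : Ω' => c) (fun _ => P) ν) :
    TendstoInMeasure P X atTop (fun _ => c) := by
  intro ε hε
  -- Portmanteau for closed sets: this one is null for the point mass at `c`.
  have hF : IsClosed {x : E | ε ≤ edist x c} :=
    isClosed_le continuous_const (continuous_id.edist continuous_const)
  have h1 := ProbabilityMeasure.limsup_measure_closed_le_of_tendsto h.tendsto hF
  simp only [ProbabilityMeasure.coe_mk] at h1
  have h2 : ν.map (fun _ => c) {x : E | ε ≤ edist x c} = 0 := by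
    rw [Measure.map_apply measurable_const hF.measurableSet]
    simp [hε.not_ge]
  rw [h2] at h1
  have h3 : Tendsto (fun k => (P.map (X k)) {x : E | ε ≤ edist x c}) atTop (𝓝 0) :=
    tendsto_of_le_liminf_of_limsup_le zero_le h1
  refine h3.congr fun k => ?_
  rw [Measure.map_apply_of_aemeasurable (h.forall_aemeasurable k) hF.measurableSet]
  rfl

theorem tendstoInDistribution_congr_limit {Ω'' : Type*} [MeasurableSpace Ω''] {ρ : Measure Ω''}
    [IsProbabilityMeasure ρ] {E : Type*} [TopologicalSpace E] [MeasurableSpace E]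
    [OpensMeasurableSpace E] {X : ℕ → Ω → E} {Z : Ω' → E} {Z' : Ω'' → E}
    (h : TendstoInDistribution X atTop Z (fun _ => P) ν) (hZ' : AEMeasurable Z' ρ)
    (hlaw : ν.map Z = ρ.map Z') :
    TendstoInDistribution X atTop Z' (fun _ => P) ρ := by
  refine ⟨h.forall_aemeasurable, hZ', ?_⟩
  have e : (⟨ρ.map Z', Measure.isProbabilityMeasure_map hZ'⟩ : ProbabilityMeasure E) =
      ⟨ν.map Z, Measure.isProbabilityMeasure_map h.aemeasurable_limit⟩ := Subtype.ext hlaw.symm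
  rw [e]
  exact h.tendsto

/-- Two sequences that coincide with probability tending to one have the same limit in
distribution. -/
theorem tendstoInDistribution_of_eventually_eq {E : Type*} [NormedAddCommGroup E]
    [SecondCountableTopology E] [MeasurableSpace E] [BorelSpace E] {X Y : ℕ → Ω → E} {Z : Ω' → E}
    (h : TendstoInDistribution X atTop Z (fun _ => P) ν) (hY : ∀ k, AEMeasurable (Y k) P)
    (hXY : ∀ᶠ p in inProb P, Y p.1 p.2 = X p.1 p.2) :
    TendstoInDistribution Y atTop Z (fun _ => P) ν := by
  refine tendstoInDistribution_of_tendstoInMeasure_sub Y Z h ?_ hY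
  refine (tendstoInMeasure_const_iff (c := (0 : E))).2 (tendsto_const_nhds.congr' ?_)
  filter_upwards [hXY] with p hp
  simp [hp]

end InProb

/-! ### Sample averages, centering and the law of large numbers -/

section Averages

theorem avg_apply {ι : Type*} (n : ℕ) (v : ℕ → ι → ℝ) (a : ι) :
    avg n v a = avg n (fun i => v i a) := by
  simp [avg]

theorem avg_sub {E : Type*} [AddCommGroup E] [Module ℝ E] (n : ℕ) (u v : ℕ → E) :
    avg n (fun i => u i - v i) = avg n u - avg n v := by
  simp [avg, smul_sub]

theorem avg_sum {κ : Type*} (s : Finset κ) (n : ℕ) (u : κ → ℕ → ℝ) :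
    avg n (fun i => ∑ t ∈ s, u t i) = ∑ t ∈ s, avg n (u t) := by
  simp only [avg, smul_eq_mul, Finset.mul_sum]
  exact Finset.sum_comm

theorem avg_mul_const (n : ℕ) (u : ℕ → ℝ) (c : ℝ) :
    avg n (fun i => u i * c) = avg n u * c := by
  simp [avg, ← Finset.sum_mul, mul_assoc]

theorem avg_const_mul (n : ℕ) (u : ℕ → ℝ) (c : ℝ) :
    avg n (fun i => c * u i) = c * avg n u := by
  simp_rw [mul_comm c, avg_mul_const]

theorem avg_centered_mul_centered (n : ℕ) (u v : ℕ → ℝ) :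
    avg n (fun i => (u i - avg n u) * (v i - avg n v)) =
      avg n (fun i => u i * v i) - avg n u * avg n v := by
  -- The average of a constant is that constant only for a nonempty sample; for `n = 0` both sides
  -- are `0`.
  rcases Nat.eq_zero_or_pos n with rfl | hn
  · simp [avg]
  have h1 : ∀ x : ℝ, avg n (fun _ => x) = x := by
    intro x
    have : (n : ℝ) ≠ 0 := by positivity
    simp [avg, this]
  simp_rw [sub_mul, mul_sub, avg_sub, avg_mul_const, avg_const_mul, h1]
  ring

theorem obs_apply {ι : Type*} (c : Centering) (n : ℕ) (v : ℕ → ι → ℝ) (i : ℕ) (a : ι) :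
    c.obs n v i a = c.obs n (fun i => v i a) i := by
  cases c <;> simp [Centering.obs, avg_apply]

/-- Expand the product of the centered observations over subsets `t`. Every term with `t` not the
full index set contains a sample mean tending to `0`, so the centered and uncentered averages have
the same limit. -/
theorem tendsto_avg_prod_obs {ι : Type*} [Fintype ι] [DecidableEq ι] (c : Centering) {n : ℕ → ℕ}
    {u : ι → ℕ → ℝ} {L : Finset ι → ℝ}
    (h : ∀ t, Tendsto (fun k => avg (n k) fun i => ∏ l ∈ t, u l i) atTop (𝓝 (L t)))
    (h0 : ∀ l, Tendsto (fun k => avg (n k) (u l)) atTop (𝓝 0)) :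
    Tendsto (fun k => avg (n k) fun i => ∏ l, c.obs (n k) (u l) i) atTop
      (𝓝 (L Finset.univ)) := by
  cases c with
  | population => exact h Finset.univ
  | sampleMean =>
    have e : ∀ k, (avg (n k) fun i => ∏ l, Centering.sampleMean.obs (n k) (u l) i) =
        ∑ t : Finset ι, avg (n k) (fun i => ∏ l ∈ t, u l i) *
          ∏ l ∈ Finset.univ \ t, (- avg (n k) (u l)) := by
      intro k
      simp only [Centering.obs, sub_eq_add_neg, Finset.prod_add, avg_sum, avg_mul_const,
        Finset.powerset_univ]
    simp_rw [e]
    have lim : ∑ t : Finset ι, L t * ∏ l ∈ Finset.univ \ t, (-(0 : ℝ)) = L Finset.univ := by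
      rw [Finset.sum_eq_single Finset.univ]
      · simp
      · intro t _ ht
        have : (Finset.univ \ t).Nonempty := by
          rw [Finset.sdiff_nonempty]
          exact fun h => ht (Finset.univ_subset_iff.1 h)
        obtain ⟨l, hl⟩ := this
        rw [Finset.prod_eq_zero hl (by simp), mul_zero]
      · simp
    rw [← lim]
    exact tendsto_finsetSum _ fun t _ => (h t).mul (tendsto_finsetProd _ fun l _ => (h0 l).neg)

variable {Ω : Type*} [MeasurableSpace Ω] {P : Measure Ω}

theorem aemeasurable_avg {n : ℕ} {v : ℕ → Ω → ℝ} (h : ∀ i, AEMeasurable (v i) P) :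
    AEMeasurable (fun ω => avg n (fun i => v i ω)) P := by
  simp only [avg, smul_eq_mul]
  exact (Finset.aemeasurable_fun_sum _ fun i _ => h i).const_mul _

theorem aemeasurable_obs (c : Centering) {n : ℕ} {v : ℕ → Ω → ℝ} (h : ∀ i, AEMeasurable (v i) P)
    (i : ℕ) : AEMeasurable (fun ω => c.obs n (fun i => v i ω) i) P := by
  cases c with
  | population => exact h i
  | sampleMean => exact (h i).sub (aemeasurable_avg h)

/-- Hölder's inequality: at most four factors in `L⁴` give exponents `1/4` summing to at most `1`.
-/
theorem integrable_prod_of_memLp_four {S ι : Type*} [MeasurableSpace S] {μ : Measure S}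
    [IsProbabilityMeasure μ] [Fintype ι] (hι : Fintype.card ι ≤ 4) {f : ι → S → ℝ}
    (h4 : ∀ l, MemLp (f l) 4 μ) (t : Finset ι) : Integrable (fun s => ∏ l ∈ t, f l s) μ := by
  have h := MemLp.prod' (s := t) (p := fun _ => 4) (fun l _ => h4 l)
  refine h.integrable ?_
  rw [Finset.sum_const, nsmul_eq_mul, ENNReal.one_le_inv]
  have h1 : t.card ≤ 4 := (Finset.card_le_univ t).trans hι
  calc (t.card : ENNReal) * 4⁻¹ ≤ 4 * 4⁻¹ := by gcongr; exact_mod_cast h1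
    _ = 1 := ENNReal.mul_inv_cancel (by simp) (by simp)

section LLN

variable {S E : Type*} [MeasurableSpace S] [MeasurableSpace E] {μ : Measure S}
  {ξ : ℕ → Ω → E} {ξ₀ : S → E}

theorem ae_tendsto_avg (hid : ∀ i, IdentDistrib (ξ i) ξ₀ P μ) (hind : iIndepFun ξ P)
    {f : E → ℝ} (hf : Measurable f) (hint : Integrable (fun s => f (ξ₀ s)) μ) :
    ∀ᵐ ω ∂P, Tendsto (fun n => avg n fun i => f (ξ i ω)) atTop (𝓝 (∫ s, f (ξ₀ s) ∂μ)) := by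
  have hid' : ∀ i, IdentDistrib (fun ω => f (ξ i ω)) (fun s => f (ξ₀ s)) P μ :=
    fun i => (hid i).comp hf
  have h := strong_law_ae_real (fun i ω => f (ξ i ω)) ((hid' 0).symm.integrable_snd hint)
    (fun i j hij => (hind.indepFun hij).comp hf hf) (fun i => (hid' i).trans (hid' 0).symm)
  filter_upwards [h] with ω hω
  rw [← (hid' 0).integral_eq]
  refine hω.congr fun n => ?_
  simp [avg, div_eq_inv_mul]

theorem tendsto_inProb_avg_prod_obs {ι : Type*} [Fintype ι] [IsProbabilityMeasure P]
    [IsProbabilityMeasure μ] (c : Centering)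
    (hid : ∀ i, IdentDistrib (ξ i) ξ₀ P μ) (hind : iIndepFun ξ P) (hι : Fintype.card ι ≤ 4)
    {f : ι → E → ℝ} (hf : ∀ l, Measurable (f l)) (h4 : ∀ l, MemLp (fun s => f l (ξ₀ s)) 4 μ)
    (h0 : ∀ l, ∫ s, f l (ξ₀ s) ∂μ = 0) {n : ℕ → ℕ} (hn : Tendsto n atTop atTop) :
    Tendsto (fun p : ℕ × Ω => avg (n p.1) fun i =>
        ∏ l, c.obs (n p.1) (fun i => f l (ξ i p.2)) i) (inProb P)
      (𝓝 (∫ s, ∏ l, f l (ξ₀ s) ∂μ)) := by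
  classical
  refine tendsto_inProb_of_ae (f := fun k ω => avg (n k) fun i =>
        ∏ l, c.obs (n k) (fun i => f l (ξ i ω)) i) (fun k => ?_) ?_
  · exact aemeasurable_avg fun i => Finset.aemeasurable_fun_prod _ fun l _ =>
      aemeasurable_obs c (fun i => (hf l).comp_aemeasurable (hid i).aemeasurable_fst) i
  · have h1 : ∀ᵐ ω ∂P, ∀ t : Finset ι, Tendsto (fun n => avg n fun i => ∏ l ∈ t, f l (ξ i ω)) atTop
        (𝓝 (∫ s, ∏ l ∈ t, f l (ξ₀ s) ∂μ)) := by
      rw [ae_all_iff]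
      exact fun t => ae_tendsto_avg hid hind (f := fun x => ∏ l ∈ t, f l x)
        (Finset.measurable_fun_prod _ fun l _ => hf l) (integrable_prod_of_memLp_four hι h4 t)
    filter_upwards [h1] with ω hω
    refine tendsto_avg_prod_obs c (u := fun l i => f l (ξ i ω))
      (L := fun t => ∫ s, ∏ l ∈ t, f l (ξ₀ s) ∂μ) (fun t => (hω t).comp hn) fun l => ?_
    have := (hω {l}).comp hn
    simp only [Finset.prod_singleton, h0] at this
    exact this

end LLN
end Averages

/-! ### Covariance matrices as quadratic forms -/

section CovarianceMatrix
variable {S : Type*} [MeasurableSpace S] {μ : Measure S} {m : ℕ}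

theorem dotProduct_varMatrix_mulVec [IsFiniteMeasure μ] {A : S → Fin m → ℝ}
    (hA : ∀ a, MemLp (fun s => A s a) 2 μ) (t : Fin m → ℝ) :
    t ⬝ᵥ varMatrix μ A *ᵥ t = Var[fun s => t ⬝ᵥ A s; μ] := by
  have h1 : ∀ a, MemLp (fun s => t a * A s a) 2 μ := fun a => (hA a).const_mul _
  rw [← covariance_self (by
    simp only [dotProduct]
    exact Finset.aemeasurable_fun_sum _ fun a _ => (h1 a).aestronglyMeasurable.aemeasurable)]
  simp only [dotProduct]
  rw [covariance_fun_sum_fun_sum h1 h1]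
  refine Finset.sum_congr rfl fun a _ => ?_
  rw [mulVec, dotProduct, Finset.mul_sum]
  refine Finset.sum_congr rfl fun b _ => ?_
  rw [covariance_const_mul_left, covariance_const_mul_right]
  simp only [varMatrix, crossCov, Matrix.of_apply]
  ring

theorem posSemidef_varMatrix [IsFiniteMeasure μ] {A : S → Fin m → ℝ}
    (hA : ∀ a, MemLp (fun s => A s a) 2 μ) : (varMatrix μ A).PosSemidef := by
  rw [posSemidef_iff_dotProduct_mulVec]
  refine ⟨?_, fun t => ?_⟩
  · ext a b
    simp [varMatrix, crossCov, covariance_comm]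
  · rw [star_trivial, dotProduct_varMatrix_mulVec hA]
    exact variance_nonneg _ _

end CovarianceMatrix

/-! ### The central limit theorem for two independent samples -/

section CentralLimit

variable {Ω S E E' : Type*} [MeasurableSpace Ω] [MeasurableSpace S] [MeasurableSpace E]
  [MeasurableSpace E'] {P : Measure Ω} {μ : Measure S} {ξ : ℕ → Ω → E} {ξ₀ : S → E} {η : ℕ → Ω → E'} {η₀ : S → E'}
  {n n' : ℕ → ℕ}

/-- The normalization `r` is kept free because it will be `√N` with `N` the total size of both
samples; the ratio to `√n` is absorbed by Slutsky's theorem. -/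
theorem tendstoInDistribution_avg [IsProbabilityMeasure P]
    (hid : ∀ i, IdentDistrib (ξ i) ξ₀ P μ) (hind : iIndepFun ξ P)
    {f : E → ℝ} (hf : Measurable f) (h2 : MemLp (fun s => f (ξ₀ s)) 2 μ)
    (hn : Tendsto n atTop atTop) {r : ℕ → ℝ} {v : ℝ}
    (hr : Tendsto (fun k => r k / √(n k)) atTop (𝓝 v)) :
    TendstoInDistribution
      (fun k ω => r k * (avg (n k) (fun i => f (ξ i ω)) - ∫ s, f (ξ₀ s) ∂μ)) atTop
      (fun x : ℝ => x * v) (fun _ => P)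
      (gaussianReal 0 Var[fun s => f (ξ₀ s); μ].toNNReal) := by
  have hid' : ∀ i, IdentDistrib (fun ω => f (ξ i ω)) (fun s => f (ξ₀ s)) P μ :=
    fun i => (hid i).comp hf
  have hm : ∀ i, AEMeasurable (fun ω => f (ξ i ω)) P := fun i => (hid' i).aemeasurable_fst
  have h1 := tendstoInDistribution_inv_sqrt_mul_sum_sub (X := fun i ω => f (ξ i ω))
    (P' := gaussianReal 0 Var[fun s => f (ξ₀ s); μ].toNNReal) (Y := id) (P := P)
    (by rw [(hid' 0).variance_eq]; exact HasLaw.id) ((hid' 0).memLp_iff.2 h2)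
    (hind.comp (fun _ => f) (fun _ => hf)) (fun i => (hid' i).trans (hid' 0).symm)
  have h2 : TendstoInDistribution (fun k ω => (√(n k : ℝ))⁻¹ *
      (∑ i ∈ Finset.range (n k), f (ξ i ω) - n k * ∫ s, f (ξ₀ s) ∂μ)) atTop
      (id : ℝ → ℝ) (fun _ => P) (gaussianReal 0 Var[fun s => f (ξ₀ s); μ].toNNReal) := by
    rw [(hid' 0).integral_eq] at h1
    exact ⟨fun k => h1.forall_aemeasurable (n k), h1.aemeasurable_limit, h1.tendsto.comp hn⟩
  have h3 := h2.continuous_comp_prodMk_of_tendstoInMeasure_const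
    (g := fun q : ℝ × ℝ => q.1 * q.2) (by fun_prop) (Y := fun k _ => r k / √(n k)) (c := v)
    (tendstoInMeasure_const_iff.2 (hr.comp tendsto_fst_inProb)) (fun k => aemeasurable_const)
  -- The two normalizations agree only for `n k > 0`, which holds for all large `k`.
  refine tendstoInDistribution_of_eventually_eq h3 (fun k => ?_) ?_
  · exact ((aemeasurable_avg hm).sub_const _).const_mul _
  · filter_upwards [tendsto_fst_inProb.eventually (hn.eventually_gt_atTop 0)] with p hp
    have h0 : (0 : ℝ) < n p.1 := by exact_mod_cast hp
    have hs := Real.mul_self_sqrt h0.le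
    have hs0 : √(n p.1 : ℝ) ≠ 0 := (Real.sqrt_pos.2 h0).ne'
    simp only [avg, smul_eq_mul]
    generalize ∑ i ∈ Finset.range (n p.1), f (ξ i p.2) = A
    generalize √(n p.1 : ℝ) = q at *
    rw [← hs]
    field_simp

/-- Evaluation at `1` is enough, because the frequency `t` of the multivariate problem is absorbed
into `f`. -/
theorem tendsto_charFun_avg [IsProbabilityMeasure P]
    (hid : ∀ i, IdentDistrib (ξ i) ξ₀ P μ) (hind : iIndepFun ξ P)
    {f : E → ℝ} (hf : Measurable f) (h2 : MemLp (fun s => f (ξ₀ s)) 2 μ)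
    (hn : Tendsto n atTop atTop) {r : ℕ → ℝ} {v : ℝ}
    (hr : Tendsto (fun k => r k / √(n k)) atTop (𝓝 v)) :
    Tendsto (fun k => charFun
      (P.map fun ω => r k * (avg (n k) (fun i => f (ξ i ω)) - ∫ s, f (ξ₀ s) ∂μ)) 1) atTop
      (𝓝 (Complex.exp (-(v ^ 2 * Var[fun s => f (ξ₀ s); μ] / 2 : ℝ)))) := by
  have h := ProbabilityMeasure.tendsto_iff_tendsto_charFun.1
    (tendstoInDistribution_avg hid hind hf h2 hn hr).tendsto 1
  simp only [ProbabilityMeasure.coe_mk] at h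
  convert! h using 2
  rw [gaussianReal_map_mul_const, charFun_gaussianReal]
  simp [Real.coe_toNNReal _ (variance_nonneg _ _)]

theorem charFun_map_euclidean {m : ℕ} {G : Ω → EuclideanSpace ℝ (Fin m)} (hG : AEMeasurable G P)
    (t : EuclideanSpace ℝ (Fin m)) :
    charFun (P.map G) t = charFun (P.map fun ω => t.ofLp ⬝ᵥ (G ω).ofLp) 1 := by
  have h1 : AEMeasurable (fun ω => t.ofLp ⬝ᵥ (G ω).ofLp) P :=
    (Continuous.measurable (f := fun x : EuclideanSpace ℝ (Fin m) => t.ofLp ⬝ᵥ x.ofLp)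
      (by simp only [dotProduct]; fun_prop)).comp_aemeasurable hG
  rw [charFun_apply, charFun_apply, integral_map hG (by fun_prop), integral_map h1 (by fun_prop)]
  congr 1
  ext ω
  simp [EuclideanSpace.inner_eq_star_dotProduct]

theorem measurable_dotProduct_left {m : ℕ} {H : E → Fin m → ℝ} (hH : Measurable H)
    (t : Fin m → ℝ) : Measurable fun x => t ⬝ᵥ H x := by
  simp only [dotProduct]
  exact Finset.measurable_fun_sum _ fun a _ => ((measurable_pi_apply a).comp hH).const_mul _

theorem measurable_mul_avg_sub {f : E → ℝ} (hf : Measurable f) (N : ℕ) (a b : ℝ) :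
    Measurable fun x : ℕ → E => a * (avg N (fun i => f (x i)) - b) := by
  simp only [avg, smul_eq_mul]
  refine (((Finset.measurable_fun_sum _ fun i _ => ?_).const_mul _).sub_const _).const_mul _
  exact hf.comp (measurable_pi_apply i)

theorem dotProduct_avg {m : ℕ} (t : Fin m → ℝ) (N : ℕ) (v : ℕ → Fin m → ℝ) :
    t ⬝ᵥ avg N v = avg N (fun i => t ⬝ᵥ v i) := by
  simp only [dotProduct, avg_apply, avg_sum, avg_const_mul]

/-- The central limit theorem for the difference of the means of two independent samples. -/
theorem tendstoInDistribution_two_sample {m : ℕ} [IsProbabilityMeasure P]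
    [IsProbabilityMeasure μ]
    (hid : ∀ i, IdentDistrib (ξ i) ξ₀ P μ) (hind : iIndepFun ξ P)
    (hid' : ∀ i, IdentDistrib (η i) η₀ P μ) (hind' : iIndepFun η P)
    (hindep : IndepFun (fun ω i => ξ i ω) (fun ω j => η j ω) P)
    {F : E → Fin m → ℝ} {G : E' → Fin m → ℝ} (hF : Measurable F) (hG : Measurable G)
    (hF2 : ∀ a, MemLp (fun s => F (ξ₀ s) a) 2 μ) (hG2 : ∀ a, MemLp (fun s => G (η₀ s) a) 2 μ)
    (hmean : ∀ a, ∫ s, F (ξ₀ s) a ∂μ = ∫ s, G (η₀ s) a ∂μ)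
    (hn : Tendsto n atTop atTop) (hn' : Tendsto n' atTop atTop) {r : ℕ → ℝ} {v v' : ℝ}
    (hr : Tendsto (fun k => r k / √(n k)) atTop (𝓝 v))
    (hr' : Tendsto (fun k => r k / √(n' k)) atTop (𝓝 v')) :
    TendstoInDistribution
      (fun k ω => r k • WithLp.toLp 2
        (avg (n k) (fun i => F (ξ i ω)) - avg (n' k) (fun j => G (η j ω)))) atTop id (fun _ => P)
      (multivariateGaussian 0 (v ^ 2 • varMatrix μ (fun s => F (ξ₀ s)) +
        v' ^ 2 • varMatrix μ (fun s => G (η₀ s)))) := by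
  have hFm : ∀ i a, AEMeasurable (fun ω => F (ξ i ω) a) P := fun i a =>
    ((measurable_pi_apply a).comp hF).comp_aemeasurable (hid i).aemeasurable_fst
  have hGm : ∀ i a, AEMeasurable (fun ω => G (η i ω) a) P := fun i a =>
    ((measurable_pi_apply a).comp hG).comp_aemeasurable (hid' i).aemeasurable_fst
  have hmeas : ∀ k, AEMeasurable (fun ω => r k • WithLp.toLp 2
      (avg (n k) (fun i => F (ξ i ω)) - avg (n' k) (fun j => G (η j ω)))) P := by
    intro k
    refine AEMeasurable.const_smul (g := fun ω => WithLp.toLp 2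
      (avg (n k) (fun i => F (ξ i ω)) - avg (n' k) (fun j => G (η j ω)))) ?_ (r k)
    refine (WithLp.measurable_toLp 2 _).comp_aemeasurable (aemeasurable_pi_lambda _ fun a => ?_)
    simp only [Pi.sub_apply, avg_apply]
    exact (aemeasurable_avg fun i => hFm i a).sub (aemeasurable_avg fun i => hGm i a)
  have hpsd : (v ^ 2 • varMatrix μ (fun s => F (ξ₀ s)) +
        v' ^ 2 • varMatrix μ (fun s => G (η₀ s))).PosSemidef :=
    ((posSemidef_varMatrix hF2).smul (sq_nonneg v)).add
      ((posSemidef_varMatrix hG2).smul (sq_nonneg v'))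
  refine ⟨hmeas, aemeasurable_id, ProbabilityMeasure.tendsto_iff_tendsto_charFun.2 fun t => ?_⟩
  simp only [ProbabilityMeasure.coe_mk, Measure.map_id]
  have dotF := measurable_dotProduct_left hF t.ofLp
  have dotG := measurable_dotProduct_left hG t.ofLp
  have dotL : ∀ {H : S → Fin m → ℝ}, (∀ a, MemLp (fun s => H s a) 2 μ) →
      MemLp (fun s => t.ofLp ⬝ᵥ H s) 2 μ := by
    intro H hH
    simp only [dotProduct]
    exact memLp_finsetSum _ fun a _ => (hH a).const_mul _
  have c1 := tendsto_charFun_avg hid hind dotF (dotL hF2) hn hr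
  -- The minus sign of the second mean is moved into its normalization; the limit involves only `v'
  -- ^ 2`.
  have c2 := tendsto_charFun_avg hid' hind' dotG (dotL hG2) hn'
    (r := fun k => - r k) (v := -v') (by simpa [neg_div] using hr'.neg)
  have hmean' : ∫ s, t.ofLp ⬝ᵥ F (ξ₀ s) ∂μ = ∫ s, t.ofLp ⬝ᵥ G (η₀ s) ∂μ := by
    simp only [dotProduct]
    rw [integral_finsetSum _ fun a _ => ((hF2 a).integrable (by norm_num)).const_mul _,
      integral_finsetSum _ fun a _ => ((hG2 a).integrable (by norm_num)).const_mul _]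
    simp only [integral_const_mul, hmean]
  -- By independence of the samples, the product of the two characteristic functions is that of the
  -- sum; the subtracted expectations cancel by `hmean'`.
  have key := c1.mul c2
  rw [charFun_multivariateGaussian hpsd]
  convert! key using 1
  · ext k
    rw [charFun_map_euclidean (hmeas k), ← Pi.mul_apply,
      ← IndepFun.charFun_map_fun_add_eq_mul]
    · congr 2
      ext ω
      simp only [WithLp.ofLp_smul, dotProduct_smul, dotProduct_sub, smul_eq_mul,
        dotProduct_avg, hmean']
      ring
    · exact ((aemeasurable_avg fun i =>
        dotF.comp_aemeasurable (hid i).aemeasurable_fst).sub_const _).const_mul _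
    · exact ((aemeasurable_avg fun i =>
        dotG.comp_aemeasurable (hid' i).aemeasurable_fst).sub_const _).const_mul _
    · exact hindep.comp (measurable_mul_avg_sub dotF (n k) (r k) (∫ s, t.ofLp ⬝ᵥ F (ξ₀ s) ∂μ))
        (measurable_mul_avg_sub dotG (n' k) (-r k) (∫ s, t.ofLp ⬝ᵥ G (η₀ s) ∂μ))
  · rw [← Complex.exp_add]
    congr 2
    rw [add_mulVec, dotProduct_add, smul_mulVec, smul_mulVec, dotProduct_smul, dotProduct_smul,
      dotProduct_varMatrix_mulVec hF2, dotProduct_varMatrix_mulVec hG2]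
    simp only [inner_zero_right, smul_eq_mul]
    push_cast
    ring

end CentralLimit

/-! ### Linear images of Gaussian vectors -/

section Gaussian
variable {m d : ℕ}

/-- Compare characteristic functions: applying `M` to the vector replaces the frequency `t` by `Mᵀ
t`. -/
theorem multivariateGaussian_map_mulVec {A : Matrix (Fin m) (Fin m) ℝ} (hA : A.PosSemidef)
    (M : Matrix (Fin d) (Fin m) ℝ) :
    (multivariateGaussian 0 A).map (fun x => WithLp.toLp 2 (M *ᵥ x.ofLp)) =
      multivariateGaussian 0 (M * A * Mᵀ) := by
  have hc : Continuous fun x : EuclideanSpace ℝ (Fin m) => WithLp.toLp 2 (M *ᵥ x.ofLp) :=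
    (PiLp.continuous_toLp 2 _).comp (continuous_const.matrix_mulVec (PiLp.continuous_ofLp 2 _))
  have := Measure.isProbabilityMeasure_map (μ := multivariateGaussian 0 A) hc.aemeasurable
  refine Measure.ext_of_charFun (funext fun t => ?_)
  have hA' : (M * A * Mᵀ).PosSemidef := by simpa using hA.mul_mul_conjTranspose_same M
  rw [charFun_multivariateGaussian hA']
  have h1 : charFun ((multivariateGaussian 0 A).map fun x => WithLp.toLp 2 (M *ᵥ x.ofLp)) t =
      charFun (multivariateGaussian 0 A) (WithLp.toLp 2 (Mᵀ *ᵥ t.ofLp)) := by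
    rw [charFun_apply, charFun_apply, integral_map hc.aemeasurable (by fun_prop)]
    congr 1
    ext x
    simp only [EuclideanSpace.inner_eq_star_dotProduct, star_trivial]
    rw [dotProduct_mulVec, mulVec_transpose]
  rw [h1, charFun_multivariateGaussian hA]
  simp only [inner_zero_right]
  congr 3
  rw [mulVec_transpose, ← dotProduct_mulVec, mulVec_mulVec, ← mulVec_transpose, mulVec_mulVec,
    Matrix.mul_assoc]

variable {Ω : Type*} [MeasurableSpace Ω] {P : Measure Ω} [IsProbabilityMeasure P]

/-- Slutsky's theorem for a random linear map applied to an asymptotically normal vector. -/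
theorem tendstoInDistribution_mulVec {A : Matrix (Fin m) (Fin m) ℝ} (hA : A.PosSemidef)
    {G : ℕ → Ω → EuclideanSpace ℝ (Fin m)} {M : ℕ → Ω → Matrix (Fin d) (Fin m) ℝ}
    {M₀ : Matrix (Fin d) (Fin m) ℝ}
    (hG : TendstoInDistribution G atTop id (fun _ => P) (multivariateGaussian 0 A))
    (hM : Tendsto (fun p : ℕ × Ω => M p.1 p.2) (inProb P) (𝓝 M₀))
    (hMm : ∀ k, AEMeasurable (M k) P) :
    TendstoInDistribution (fun k ω => WithLp.toLp 2 (M k ω *ᵥ (G k ω).ofLp)) atTop id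
      (fun _ => P) (multivariateGaussian 0 (M₀ * A * M₀ᵀ)) := by
  have hc : Continuous fun q : EuclideanSpace ℝ (Fin m) × (Fin d → Fin m → ℝ) =>
      (WithLp.toLp 2 (Matrix.of q.2 *ᵥ q.1.ofLp) : EuclideanSpace ℝ (Fin d)) :=
    (PiLp.continuous_toLp 2 _).comp
      (Continuous.matrix_mulVec continuous_snd ((PiLp.continuous_ofLp 2 _).comp continuous_fst))
  have h := hG.continuous_comp_prodMk_of_tendstoInMeasure_const hc
    (Y := fun k ω => (M k ω : Fin d → Fin m → ℝ)) (c := M₀)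
    (tendstoInMeasure_const_iff.2 hM) hMm
  refine tendstoInDistribution_congr_limit h aemeasurable_id ?_
  rw [Measure.map_id]
  exact multivariateGaussian_map_mulVec hA M₀

end Gaussian

/-! ### Entrywise formulas for the sample moments -/

section Moments
variable {m d : ℕ}

theorem momentIX_apply (n : ℕ) (I : ℕ → Fin m → ℝ) (X : ℕ → Fin d → ℝ) (a : Fin m) (b : Fin d) :
    momentIX n I X a b = avg n fun j => I j a * X j b := by
  simp [momentIX, avg, Matrix.sum_apply, vecMulVec_apply]

theorem momentIY_apply (n : ℕ) (I : ℕ → Fin m → ℝ) (Y : ℕ → ℝ) (a : Fin m) :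
    momentIY n I Y a = avg n fun j => Y j * I j a := by
  simp [momentIY, avg]

theorem empVar_apply (n : ℕ) (v : ℕ → Fin m → ℝ) (a b : Fin m) :
    empVar n v a b = (avg n fun i => v i a * v i b) -
      (avg n fun i => v i a) * avg n fun i => v i b := by
  rw [← avg_centered_mul_centered]
  simp [empVar, avg, Matrix.sum_apply, vecMulVec_apply]

theorem posSemidef_empVar (n : ℕ) (v : ℕ → Fin m → ℝ) : (empVar n v).PosSemidef := by
  rw [empVar, avg]
  refine PosSemidef.smul (posSemidef_sum _ fun i _ => ?_) (by positivity)
  simpa using posSemidef_vecMulVec_self_star (v i - avg n v)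

/-- This exhibits `Ĉβ` as a sample mean, so that `ĝ(β)` is a difference of two sample means. -/
theorem momentIX_mulVec (n : ℕ) (I : ℕ → Fin m → ℝ) (X : ℕ → Fin d → ℝ) (β : Fin d → ℝ) :
    momentIX n I X *ᵥ β = avg n fun j => (X j ⬝ᵥ β) • I j := by
  ext a
  simp only [mulVec, dotProduct, momentIX_apply, avg_apply, Pi.smul_apply, smul_eq_mul,
    Finset.sum_mul, avg_sum, ← avg_mul_const]
  exact Finset.sum_congr rfl fun b _ => congrArg _ (funext fun i => by ring)

theorem avg_obs_mul_obs (c : Centering) (n : ℕ) (u v : ℕ → ℝ) :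
    (avg n fun i => c.obs n u i * c.obs n v i) = (avg n fun i => u i * v i) -
      match c with
      | .population => 0
      | .sampleMean => avg n u * avg n v := by
  cases c with
  | population => simp [Centering.obs]
  | sampleMean => exact avg_centered_mul_centered n u v

end Moments

/-! ### Limits in probability of averages of products -/

section Limits
variable {Ω S E : Type*} [MeasurableSpace Ω] [MeasurableSpace S] [MeasurableSpace E]
  {P : Measure Ω} [IsProbabilityMeasure P] {μ : Measure S} [IsProbabilityMeasure μ]
  {ξ : ℕ → Ω → E} {ξ₀ : S → E} {n : ℕ → ℕ}

theorem tendsto_inProb_avg_mul (c : Centering)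
    (hid : ∀ i, IdentDistrib (ξ i) ξ₀ P μ) (hind : iIndepFun ξ P)
    {f g : E → ℝ} (hf : Measurable f) (hg : Measurable g)
    (hf4 : MemLp (fun s => f (ξ₀ s)) 4 μ) (hg4 : MemLp (fun s => g (ξ₀ s)) 4 μ)
    (hf0 : ∫ s, f (ξ₀ s) ∂μ = 0) (hg0 : ∫ s, g (ξ₀ s) ∂μ = 0)
    (hn : Tendsto n atTop atTop) :
    Tendsto (fun p : ℕ × Ω => avg (n p.1) fun i => c.obs (n p.1) (fun i => f (ξ i p.2)) i *
        c.obs (n p.1) (fun i => g (ξ i p.2)) i) (inProb P)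
      (𝓝 (∫ s, f (ξ₀ s) * g (ξ₀ s) ∂μ)) := by
  have h := tendsto_inProb_avg_prod_obs c hid hind (f := ![f, g]) (by simp)
    (by simp [Fin.forall_fin_succ, hf, hg]) (by simp [Fin.forall_fin_succ, hf4, hg4])
    (by simp [Fin.forall_fin_succ, hf0, hg0]) hn
  simpa [Fin.prod_univ_two] using h

theorem tendsto_inProb_avg_mul_mul_mul (c : Centering)
    (hid : ∀ i, IdentDistrib (ξ i) ξ₀ P μ) (hind : iIndepFun ξ P)
    {f g h k : E → ℝ} (hf : Measurable f) (hg : Measurable g) (hh : Measurable h)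
    (hk : Measurable k)
    (hf4 : MemLp (fun s => f (ξ₀ s)) 4 μ) (hg4 : MemLp (fun s => g (ξ₀ s)) 4 μ)
    (hh4 : MemLp (fun s => h (ξ₀ s)) 4 μ) (hk4 : MemLp (fun s => k (ξ₀ s)) 4 μ)
    (hf0 : ∫ s, f (ξ₀ s) ∂μ = 0) (hg0 : ∫ s, g (ξ₀ s) ∂μ = 0)
    (hh0 : ∫ s, h (ξ₀ s) ∂μ = 0) (hk0 : ∫ s, k (ξ₀ s) ∂μ = 0)
    (hn : Tendsto n atTop atTop) :
    Tendsto (fun p : ℕ × Ω => avg (n p.1) fun i => c.obs (n p.1) (fun i => f (ξ i p.2)) i *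
        c.obs (n p.1) (fun i => g (ξ i p.2)) i * c.obs (n p.1) (fun i => h (ξ i p.2)) i *
        c.obs (n p.1) (fun i => k (ξ i p.2)) i) (inProb P)
      (𝓝 (∫ s, f (ξ₀ s) * g (ξ₀ s) * h (ξ₀ s) * k (ξ₀ s) ∂μ)) := by
  have h := tendsto_inProb_avg_prod_obs c hid hind (f := ![f, g, h, k]) (by simp)
    (by simp [Fin.forall_fin_succ, hf, hg, hh, hk])
    (by simp [Fin.forall_fin_succ, hf4, hg4, hh4, hk4])
    (by simp [Fin.forall_fin_succ, hf0, hg0, hh0, hk0]) hn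
  simpa [Fin.prod_univ_four] using h

/-- The first mean, scaled by `r`, converges in distribution and the second tends to `0`, so the
product tends to `0` by Slutsky's theorem. This is why centering has no first-order effect. -/
theorem tendsto_inProb_mul_avg_mul_avg
    (hid : ∀ i, IdentDistrib (ξ i) ξ₀ P μ) (hind : iIndepFun ξ P)
    {f g : E → ℝ} (hf : Measurable f) (hg : Measurable g)
    (hf2 : MemLp (fun s => f (ξ₀ s)) 2 μ) (hg2 : MemLp (fun s => g (ξ₀ s)) 2 μ)
    (hf0 : ∫ s, f (ξ₀ s) ∂μ = 0) (hg0 : ∫ s, g (ξ₀ s) ∂μ = 0)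
    (hn : Tendsto n atTop atTop) {r : ℕ → ℝ} {v : ℝ}
    (hr : Tendsto (fun k => r k / √(n k)) atTop (𝓝 v)) :
    Tendsto (fun p : ℕ × Ω => r p.1 * ((avg (n p.1) fun i => f (ξ i p.2)) *
      avg (n p.1) fun i => g (ξ i p.2))) (inProb P) (𝓝 0) := by
  have hgm : ∀ k, AEMeasurable (fun ω => avg (n k) fun i => g (ξ i ω)) P := fun k =>
    aemeasurable_avg fun i => hg.comp_aemeasurable (hid i).aemeasurable_fst
  have h1 := tendstoInDistribution_avg hid hind hf hf2 hn hr
  have h2 : Tendsto (fun p : ℕ × Ω => avg (n p.1) fun i => g (ξ i p.2)) (inProb P) (𝓝 0) := by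
    refine tendsto_inProb_of_ae (f := fun k ω => avg (n k) fun i => g (ξ i ω)) hgm ?_
    filter_upwards [ae_tendsto_avg hid hind hg (hg2.integrable (by norm_num))] with ω hω
    rw [hg0] at hω
    exact hω.comp hn
  have h3 := h1.continuous_comp_prodMk_of_tendstoInMeasure_const
    (g := fun q : ℝ × ℝ => q.1 * q.2) (by fun_prop)
    (Y := fun k ω => avg (n k) fun i => g (ξ i ω)) (c := 0)
    (tendstoInMeasure_const_iff.2 h2) hgm
  simp only [mul_zero, hf0, sub_zero, mul_assoc] at h3
  have h4 := tendstoInMeasure_of_tendstoInDistribution_const h3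
  rwa [tendstoInMeasure_const_iff] at h4

end Limits

/-! ### Exogeneity implies uncorrelatedness -/

section Exogeneity

/-- The factor `I a` is measurable for `σ(I)`, so it can be pulled out of the conditional
expectation. -/
theorem integral_mul_eq_zero_of_condExp {S : Type*} [MeasurableSpace S] {μ : Measure S}
    [IsProbabilityMeasure μ] {m : ℕ} {I : S → Fin m → ℝ} (hI : Measurable I) {ε : S → ℝ}
    (hε : MemLp ε 2 μ) (a : Fin m) (hIa : MemLp (fun s => I s a) 2 μ)
    (hexo : μ[ε | MeasurableSpace.comap I inferInstance] =ᵐ[μ] 0) :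
    ∫ s, ε s * I s a ∂μ = 0 := by
  have hm : MeasurableSpace.comap I inferInstance ≤ ‹MeasurableSpace S› := hI.comap_le
  have hmeas : StronglyMeasurable[MeasurableSpace.comap I inferInstance] fun s => I s a :=
    ((measurable_pi_apply a).comp (comap_measurable I)).stronglyMeasurable
  have h1 := condExp_mul_of_stronglyMeasurable_right (m := MeasurableSpace.comap I inferInstance)
    (f := ε) hmeas (hε.integrable_mul hIa) (hε.integrable (by norm_num))
  have h2 : ∫ s, (ε * fun s => I s a) s ∂μ = 0 := by
    rw [← integral_condExp hm, integral_congr_ae h1]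
    refine (integral_congr_ae ?_).trans (integral_zero S ℝ)
    filter_upwards [hexo] with s hs
    simp [hs]
  exact h2

end Exogeneity

/-! ### Population moments and the moment condition -/

section PopulationMoments
variable {S : Type*} [MeasurableSpace S] {μ : Measure S}

theorem memLp_two_mul {f g : S → ℝ} (hf : MemLp f 4 μ) (hg : MemLp g 4 μ) :
    MemLp (fun s => f s * g s) 2 μ := by
  have : ENNReal.HolderTriple 4 4 2 := ⟨by
    rw [← two_mul, show (4 : ENNReal) = 2 * 2 by norm_num,
      ENNReal.mul_inv (by simp) (by simp), ← mul_assoc, ENNReal.mul_inv_cancel (by simp) (by simp),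
      one_mul]⟩
  exact hg.mul hf

theorem memLp_two_of_four [IsFiniteMeasure μ] {f : S → ℝ} (hf : MemLp f 4 μ) : MemLp f 2 μ :=
  hf.mono_exponent (by norm_num)

theorem memLp_dotProduct {d : ℕ} {p : ENNReal} {X : S → Fin d → ℝ}
    (hX : ∀ b, MemLp (fun s => X s b) p μ) (β : Fin d → ℝ) :
    MemLp (fun s => X s ⬝ᵥ β) p μ := by
  simp only [dotProduct]
  exact memLp_finsetSum _ fun b _ => (hX b).mul_const _

variable [IsProbabilityMeasure μ] {m d : ℕ} {I : S → Fin m → ℝ} {X : S → Fin d → ℝ}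

theorem crossCov_apply_of_centered (hI : ∀ a, MemLp (fun s => I s a) 4 μ)
    (hX : ∀ b, MemLp (fun s => X s b) 4 μ) (hI0 : ∀ a, ∫ s, I s a ∂μ = 0) (a : Fin m) (b : Fin d) :
    crossCov μ I X a b = ∫ s, I s a * X s b ∂μ := by
  simp only [crossCov, Matrix.of_apply]
  rw [covariance_eq_sub (memLp_two_of_four (hI a)) (memLp_two_of_four (hX b)), hI0 a, zero_mul,
    sub_zero]
  rfl

theorem integral_dotProduct_mul (hI : ∀ a, MemLp (fun s => I s a) 4 μ)
    (hX : ∀ b, MemLp (fun s => X s b) 4 μ) (hI0 : ∀ a, ∫ s, I s a ∂μ = 0) (β : Fin d → ℝ)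
    (a : Fin m) : ∫ s, (X s ⬝ᵥ β) * I s a ∂μ = (crossCov μ I X *ᵥ β) a := by
  simp only [mulVec, dotProduct, Finset.sum_mul, crossCov_apply_of_centered hI hX hI0]
  rw [integral_finsetSum]
  · refine Finset.sum_congr rfl fun b _ => ?_
    rw [← integral_mul_const]
    exact integral_congr_ae (.of_forall fun s => by ring)
  · intro b _
    have := ((memLp_two_mul (hX b) (hI a)).integrable (by norm_num)).mul_const (β b)
    exact this.congr (.of_forall fun s => by ring)

theorem integrable_mul_mul_mul {f g h k : S → ℝ} (hf : MemLp f 4 μ) (hg : MemLp g 4 μ)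
    (hh : MemLp h 4 μ) (hk : MemLp k 4 μ) : Integrable (fun s => f s * g s * h s * k s) μ := by
  have := integrable_prod_of_memLp_four (μ := μ) (f := ![f, g, h, k]) (by simp)
    (by simp [Fin.forall_fin_succ, hf, hg, hh, hk]) Finset.univ
  simpa [Fin.prod_univ_four] using this

/-- A quadratic polynomial in `β` with fourth moments as coefficients; the empirical counterpart can
then be compared coefficient by coefficient. -/
theorem integral_dotProduct_mul_mul (hI : ∀ a, MemLp (fun s => I s a) 4 μ)
    (hX : ∀ b, MemLp (fun s => X s b) 4 μ) (β : Fin d → ℝ) (a a' : Fin m) :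
    ∫ s, ((X s ⬝ᵥ β) * I s a) * ((X s ⬝ᵥ β) * I s a') ∂μ =
      ∑ b, ∑ b', β b * β b' * ∫ s, X s b * I s a * X s b' * I s a' ∂μ := by
  have e : ∀ s, ((X s ⬝ᵥ β) * I s a) * ((X s ⬝ᵥ β) * I s a') =
      ∑ b, ∑ b', β b * β b' * (X s b * I s a * X s b' * I s a') := by
    intro s
    simp only [dotProduct, Finset.sum_mul, Finset.mul_sum]
    exact Finset.sum_congr rfl fun b _ => Finset.sum_congr rfl fun b' _ => by ring
  have hint : ∀ b b', Integrable (fun s => β b * β b' * (X s b * I s a * X s b' * I s a')) μ :=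
    fun b b' => (integrable_mul_mul_mul (hX b) (hI a) (hX b') (hI a')).const_mul _
  simp only [e]
  rw [integral_finsetSum _ fun b _ => integrable_finsetSum _ fun b' _ => hint b b']
  refine Finset.sum_congr rfl fun b _ => ?_
  rw [integral_finsetSum _ fun b' _ => hint b b']
  exact Finset.sum_congr rfl fun b' _ => integral_const_mul _ _

theorem varMatrix_smul_apply {Y : S → ℝ} (hI : ∀ a, MemLp (fun s => I s a) 4 μ)
    (hY : MemLp Y 4 μ) (a b : Fin m) :
    varMatrix μ (fun s => Y s • I s) a b = (∫ s, (Y s * I s a) * (Y s * I s b) ∂μ) -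
      (∫ s, Y s * I s a ∂μ) * ∫ s, Y s * I s b ∂μ := by
  simp only [varMatrix, crossCov, Matrix.of_apply, Pi.smul_apply, smul_eq_mul]
  rw [covariance_eq_sub (memLp_two_mul hY (hI a)) (memLp_two_mul hY (hI b))]
  rfl

/-- The moment condition `E[I Y] = C β`. -/
theorem integral_mul_eq_crossCov_mulVec {Y ε : S → ℝ} {β : EuclideanSpace ℝ (Fin d)}
    (hIm : Measurable I) (hYX : ∀ᵐ s ∂μ, Y s = X s ⬝ᵥ β.ofLp + ε s)
    (hI : ∀ a, MemLp (fun s => I s a) 4 μ) (hX : ∀ b, MemLp (fun s => X s b) 4 μ)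
    (hY : MemLp Y 4 μ) (hI0 : ∀ a, ∫ s, I s a ∂μ = 0)
    (hexo : μ[ε | MeasurableSpace.comap I inferInstance] =ᵐ[μ] 0) (a : Fin m) :
    ∫ s, Y s * I s a ∂μ = (crossCov μ I X *ᵥ β.ofLp) a := by
  have hXβ : MemLp (fun s => X s ⬝ᵥ β.ofLp) 4 μ := memLp_dotProduct hX _
  -- The error inherits its fourth moment from `Y - Xᵀβ`.
  have hε : MemLp ε 4 μ := by
    refine (memLp_congr_ae ?_).1 (hY.sub hXβ)
    filter_upwards [hYX] with s hs
    simp [hs]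
  have h0 := integral_mul_eq_zero_of_condExp hIm (memLp_two_of_four hε) a
    (memLp_two_of_four (hI a)) hexo
  rw [← integral_dotProduct_mul hI hX hI0, ← add_zero (∫ s, (X s ⬝ᵥ β.ofLp) * I s a ∂μ), ← h0,
    ← integral_add ((memLp_two_mul hXβ (hI a)).integrable (by norm_num))
      ((memLp_two_mul hε (hI a)).integrable (by norm_num))]
  refine integral_congr_ae ?_
  filter_upwards [hYX] with s hs
  rw [hs, add_mul]

end PopulationMoments

/-! ### Consistency of the sample moments and empirical covariances -/

section SampleMoments
variable {Ω S : Type*} [MeasurableSpace Ω] [MeasurableSpace S]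
  {P : Measure Ω} [IsProbabilityMeasure P] {μ : Measure S} [IsProbabilityMeasure μ]
  {m d : ℕ} {n : ℕ → ℕ} {I : S → Fin m → ℝ} {Is : ℕ → Ω → Fin m → ℝ} (c : Centering)

section ProductSample
variable {X : S → Fin d → ℝ} {Xs : ℕ → Ω → Fin d → ℝ}

theorem tendsto_momentIX
    (hid : ∀ j, IdentDistrib (fun ω => (Is j ω, Xs j ω)) (fun s => (I s, X s)) P μ)
    (hind : iIndepFun (fun j ω => (Is j ω, Xs j ω)) P)
    (hI : ∀ a, MemLp (fun s => I s a) 4 μ) (hX : ∀ b, MemLp (fun s => X s b) 4 μ)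
    (hI0 : ∀ a, ∫ s, I s a ∂μ = 0) (hX0 : ∀ b, ∫ s, X s b ∂μ = 0) (hn : Tendsto n atTop atTop) :
    Tendsto (fun p : ℕ × Ω => momentIX (n p.1) (c.obs (n p.1) fun j => Is j p.2)
      (c.obs (n p.1) fun j => Xs j p.2)) (inProb P) (𝓝 (crossCov μ I X)) := by
  refine tendsto_pi_nhds.2 fun a => tendsto_pi_nhds.2 fun b => ?_
  simp only [momentIX_apply, obs_apply]
  rw [crossCov_apply_of_centered hI hX hI0]
  exact tendsto_inProb_avg_mul c hid hind (f := fun z => z.1 a) (g := fun z => z.2 b)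
    (by fun_prop) (by fun_prop) (hI a) (hX b) (hI0 a) (hX0 b) hn

/-- The preliminary estimator may depend on the sample, so the law of large numbers does not apply
to the summands themselves. The entries are polynomials in `b₀` whose coefficients are averages free
of `b₀`; these converge, and `b₀` converges to `β`. -/
theorem tendsto_empVar_dotProduct_smul
    (hid : ∀ j, IdentDistrib (fun ω => (Is j ω, Xs j ω)) (fun s => (I s, X s)) P μ)
    (hind : iIndepFun (fun j ω => (Is j ω, Xs j ω)) P)
    (hI : ∀ a, MemLp (fun s => I s a) 4 μ) (hX : ∀ b, MemLp (fun s => X s b) 4 μ)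
    (hI0 : ∀ a, ∫ s, I s a ∂μ = 0) (hX0 : ∀ b, ∫ s, X s b ∂μ = 0) (hn : Tendsto n atTop atTop)
    {b₀ : ℕ → Ω → EuclideanSpace ℝ (Fin d)} {β : EuclideanSpace ℝ (Fin d)}
    (hb₀ : Tendsto (fun p : ℕ × Ω => b₀ p.1 p.2) (inProb P) (𝓝 β)) :
    Tendsto (fun p : ℕ × Ω => empVar (n p.1) fun j =>
      ((c.obs (n p.1) fun j => Xs j p.2) j ⬝ᵥ (b₀ p.1 p.2).ofLp) •
        (c.obs (n p.1) fun j => Is j p.2) j) (inProb P)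
      (𝓝 (varMatrix μ fun s => (X s ⬝ᵥ β.ofLp) • I s)) := by
  have hb : Tendsto (fun p : ℕ × Ω => (b₀ p.1 p.2).ofLp) (inProb P) (𝓝 β.ofLp) :=
    ((PiLp.continuous_ofLp 2 _).tendsto β).comp hb₀
  have hmean : ∀ a, Tendsto (fun p : ℕ × Ω => avg (n p.1) fun j =>
      ((c.obs (n p.1) fun j => Xs j p.2) j ⬝ᵥ (b₀ p.1 p.2).ofLp) *
        (c.obs (n p.1) fun j => Is j p.2) j a) (inProb P)
      (𝓝 (∫ s, (X s ⬝ᵥ β.ofLp) * I s a ∂μ)) := by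
    intro a
    rw [integral_dotProduct_mul hI hX hI0]
    have h1 := ((continuous_fst.matrix_mulVec continuous_snd).tendsto
      (crossCov μ I X, β.ofLp)).comp
        ((tendsto_momentIX c hid hind hI hX hI0 hX0 hn).prodMk_nhds hb)
    refine (tendsto_pi_nhds.1 h1 a).congr fun p => ?_
    simp only [Function.comp_apply, momentIX_mulVec, avg_apply, Pi.smul_apply, smul_eq_mul]
  refine tendsto_pi_nhds.2 fun a => tendsto_pi_nhds.2 fun a' => ?_
  simp only [empVar_apply, Pi.smul_apply, smul_eq_mul]
  rw [varMatrix_smul_apply hI (memLp_dotProduct hX _)]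
  refine Tendsto.sub ?_ ((hmean a).mul (hmean a'))
  rw [integral_dotProduct_mul_mul hI hX]
  have h2 : Tendsto (fun p : ℕ × Ω => ∑ b, ∑ b', (b₀ p.1 p.2).ofLp b * (b₀ p.1 p.2).ofLp b' *
      avg (n p.1) fun j => c.obs (n p.1) (fun j => Xs j p.2 b) j *
        c.obs (n p.1) (fun j => Is j p.2 a) j * c.obs (n p.1) (fun j => Xs j p.2 b') j *
        c.obs (n p.1) (fun j => Is j p.2 a') j) (inProb P)
      (𝓝 (∑ b, ∑ b', β.ofLp b * β.ofLp b' * ∫ s, X s b * I s a * X s b' * I s a' ∂μ)) := by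
    refine tendsto_finsetSum _ fun b _ => tendsto_finsetSum _ fun b' _ => ?_
    refine ((tendsto_pi_nhds.1 hb b).mul (tendsto_pi_nhds.1 hb b')).mul ?_
    exact tendsto_inProb_avg_mul_mul_mul c hid hind (f := fun z => z.2 b) (g := fun z => z.1 a)
      (h := fun z => z.2 b') (k := fun z => z.1 a') (by fun_prop) (by fun_prop) (by fun_prop)
      (by fun_prop) (hX b) (hI a) (hX b') (hI a') (hX0 b) (hI0 a) (hX0 b') (hI0 a') hn
  refine h2.congr fun p => ?_
  simp only [← avg_const_mul, ← avg_sum]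
  congr 1
  ext j
  simp only [dotProduct, obs_apply, Finset.sum_mul, Finset.mul_sum]
  exact Finset.sum_congr rfl fun b _ => Finset.sum_congr rfl fun b' _ => by ring

end ProductSample

section ResponseSample
variable {Y : S → ℝ} {Ys : ℕ → Ω → ℝ}

theorem tendsto_momentIY
    (hid : ∀ i, IdentDistrib (fun ω => (Is i ω, Ys i ω)) (fun s => (I s, Y s)) P μ)
    (hind : iIndepFun (fun i ω => (Is i ω, Ys i ω)) P)
    (hI : ∀ a, MemLp (fun s => I s a) 4 μ) (hY : MemLp Y 4 μ)
    (hI0 : ∀ a, ∫ s, I s a ∂μ = 0) (hY0 : ∫ s, Y s ∂μ = 0) (hn : Tendsto n atTop atTop) :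
    Tendsto (fun p : ℕ × Ω => momentIY (n p.1) (c.obs (n p.1) fun i => Is i p.2)
      (c.obs (n p.1) fun i => Ys i p.2)) (inProb P) (𝓝 fun a => ∫ s, Y s * I s a ∂μ) := by
  refine tendsto_pi_nhds.2 fun a => ?_
  simp only [momentIY_apply, obs_apply]
  exact tendsto_inProb_avg_mul c hid hind (f := fun z => z.2) (g := fun z => z.1 a)
    (by fun_prop) (by fun_prop) hY (hI a) hY0 (hI0 a) hn

theorem tendsto_empVar_smul
    (hid : ∀ i, IdentDistrib (fun ω => (Is i ω, Ys i ω)) (fun s => (I s, Y s)) P μ)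
    (hind : iIndepFun (fun i ω => (Is i ω, Ys i ω)) P)
    (hI : ∀ a, MemLp (fun s => I s a) 4 μ) (hY : MemLp Y 4 μ)
    (hI0 : ∀ a, ∫ s, I s a ∂μ = 0) (hY0 : ∫ s, Y s ∂μ = 0) (hn : Tendsto n atTop atTop) :
    Tendsto (fun p : ℕ × Ω => empVar (n p.1) fun i =>
      (c.obs (n p.1) fun i => Ys i p.2) i • (c.obs (n p.1) fun i => Is i p.2) i) (inProb P)
      (𝓝 (varMatrix μ fun s => Y s • I s)) := by
  refine tendsto_pi_nhds.2 fun a => tendsto_pi_nhds.2 fun b => ?_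
  simp only [empVar_apply, Pi.smul_apply, smul_eq_mul, obs_apply]
  rw [varMatrix_smul_apply hI hY]
  have hmean : ∀ a, Tendsto (fun p : ℕ × Ω => avg (n p.1) fun i =>
      c.obs (n p.1) (fun i => Ys i p.2) i * c.obs (n p.1) (fun i => Is i p.2 a) i) (inProb P)
      (𝓝 (∫ s, Y s * I s a ∂μ)) := fun a =>
    tendsto_inProb_avg_mul c hid hind (f := fun z => z.2) (g := fun z => z.1 a)
      (by fun_prop) (by fun_prop) hY (hI a) hY0 (hI0 a) hn
  refine Tendsto.sub ?_ ((hmean a).mul (hmean b))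
  have h := tendsto_inProb_avg_mul_mul_mul c hid hind (f := fun z => z.2) (g := fun z => z.1 a)
      (h := fun z => z.2) (k := fun z => z.1 b) (by fun_prop) (by fun_prop) (by fun_prop)
      (by fun_prop) hY (hI a) hY (hI b) hY0 (hI0 a) hY0 (hI0 b) hn
  simpa only [← mul_assoc] using h

end ResponseSample
end SampleMoments

/-! ### Continuity of the matrix operations along a filter -/

section MatrixLimits
variable {α : Type*} {l : Filter α} {p q r : ℕ}

theorem tendsto_matrix_mul {A : α → Matrix (Fin p) (Fin q) ℝ} {B : α → Matrix (Fin q) (Fin r) ℝ}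
    {A₀ : Matrix (Fin p) (Fin q) ℝ} {B₀ : Matrix (Fin q) (Fin r) ℝ}
    (hA : Tendsto A l (𝓝 A₀)) (hB : Tendsto B l (𝓝 B₀)) :
    Tendsto (fun x => A x * B x) l (𝓝 (A₀ * B₀)) :=
  ((continuous_fst.matrix_mul continuous_snd).tendsto (A₀, B₀)).comp (hA.prodMk_nhds hB)

theorem tendsto_matrix_transpose {A : α → Matrix (Fin p) (Fin q) ℝ}
    {A₀ : Matrix (Fin p) (Fin q) ℝ} (hA : Tendsto A l (𝓝 A₀)) :
    Tendsto (fun x => (A x)ᵀ) l (𝓝 A₀ᵀ) :=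
  (continuous_id.matrix_transpose.tendsto A₀).comp hA

theorem tendsto_matrix_det {A : α → Matrix (Fin p) (Fin p) ℝ} {A₀ : Matrix (Fin p) (Fin p) ℝ}
    (hA : Tendsto A l (𝓝 A₀)) : Tendsto (fun x => (A x).det) l (𝓝 A₀.det) :=
  (continuous_id.matrix_det.tendsto A₀).comp hA

theorem tendsto_matrix_inv {A : α → Matrix (Fin p) (Fin p) ℝ} {A₀ : Matrix (Fin p) (Fin p) ℝ}
    (hA : Tendsto A l (𝓝 A₀)) (h0 : A₀.det ≠ 0) : Tendsto (fun x => (A x)⁻¹) l (𝓝 A₀⁻¹) := by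
  simp only [Matrix.inv_def, Ring.inverse_eq_inv']
  exact ((tendsto_matrix_det hA).inv₀ h0).smul
    ((continuous_id.matrix_adjugate.tendsto A₀).comp hA)

theorem tendsto_gram {C : α → Matrix (Fin p) (Fin q) ℝ} {W : α → Matrix (Fin p) (Fin p) ℝ}
    {C₀ : Matrix (Fin p) (Fin q) ℝ} {W₀ : Matrix (Fin p) (Fin p) ℝ}
    (hC : Tendsto C l (𝓝 C₀)) (hW : Tendsto W l (𝓝 W₀)) :
    Tendsto (fun x => (C x)ᵀ * W x * C x) l (𝓝 (C₀ᵀ * W₀ * C₀)) :=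
  tendsto_matrix_mul (tendsto_matrix_mul (tendsto_matrix_transpose hC) hW) hC

theorem tendsto_gmmMatrix {C : α → Matrix (Fin p) (Fin q) ℝ} {W : α → Matrix (Fin p) (Fin p) ℝ}
    {C₀ : Matrix (Fin p) (Fin q) ℝ} {W₀ : Matrix (Fin p) (Fin p) ℝ}
    (hC : Tendsto C l (𝓝 C₀)) (hW : Tendsto W l (𝓝 W₀)) (h0 : (C₀ᵀ * W₀ * C₀).det ≠ 0) :
    Tendsto (fun x => gmmMatrix (C x) (W x)) l (𝓝 (gmmMatrix C₀ W₀)) :=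
  tendsto_matrix_mul (tendsto_matrix_inv (tendsto_gram hC hW) h0)
    (tendsto_matrix_mul (tendsto_matrix_transpose hC) hW)

theorem tendsto_sandwich {C : α → Matrix (Fin p) (Fin q) ℝ} {A W : α → Matrix (Fin p) (Fin p) ℝ}
    {C₀ : Matrix (Fin p) (Fin q) ℝ} {A₀ W₀ : Matrix (Fin p) (Fin p) ℝ}
    (hC : Tendsto C l (𝓝 C₀)) (hA : Tendsto A l (𝓝 A₀)) (hW : Tendsto W l (𝓝 W₀))
    (h0 : (C₀ᵀ * W₀ * C₀).det ≠ 0) :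
    Tendsto (fun x => sandwich (C x) (A x) (W x)) l (𝓝 (sandwich C₀ A₀ W₀)) := by
  have hi := tendsto_matrix_inv (tendsto_gram hC hW) h0
  have ht := tendsto_matrix_mul (tendsto_matrix_transpose hC) hW
  exact tendsto_matrix_mul (tendsto_matrix_mul hi (tendsto_matrix_mul
    (tendsto_matrix_mul (tendsto_matrix_mul ht hA) hW) hC)) hi

end MatrixLimits

/-! ### Measurability of the matrix-valued statistics -/

section MatrixMeasurability
variable {Ω : Type*} [MeasurableSpace Ω] {P : Measure Ω} {p q r : ℕ}

theorem aemeasurable_matrix {A : Ω → Matrix (Fin p) (Fin q) ℝ}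
    (h : ∀ a b, AEMeasurable (fun ω => A ω a b) P) : AEMeasurable A P :=
  aemeasurable_pi_lambda _ fun a => aemeasurable_pi_lambda _ fun b => h a b

theorem aemeasurable_matrix_mul {A : Ω → Matrix (Fin p) (Fin q) ℝ}
    {B : Ω → Matrix (Fin q) (Fin r) ℝ} (hA : AEMeasurable A P) (hB : AEMeasurable B P) :
    AEMeasurable (fun ω => A ω * B ω) P :=
  (continuous_fst.matrix_mul continuous_snd).measurable.comp_aemeasurable (hA.prodMk hB)

theorem aemeasurable_matrix_transpose {A : Ω → Matrix (Fin p) (Fin q) ℝ}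
    (hA : AEMeasurable A P) : AEMeasurable (fun ω => (A ω)ᵀ) P :=
  continuous_id.matrix_transpose.measurable.comp_aemeasurable hA

theorem aemeasurable_matrix_inv {A : Ω → Matrix (Fin p) (Fin p) ℝ} (hA : AEMeasurable A P) :
    AEMeasurable (fun ω => (A ω)⁻¹) P :=
  measurable_matrix_inv.comp_aemeasurable hA

theorem aemeasurable_gmmMatrix {C : Ω → Matrix (Fin p) (Fin q) ℝ}
    {W : Ω → Matrix (Fin p) (Fin p) ℝ} (hC : AEMeasurable C P) (hW : AEMeasurable W P) :
    AEMeasurable (fun ω => gmmMatrix (C ω) (W ω)) P := by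
  have ht := aemeasurable_matrix_mul (aemeasurable_matrix_transpose hC) hW
  exact aemeasurable_matrix_mul (aemeasurable_matrix_inv (aemeasurable_matrix_mul ht hC)) ht

theorem aemeasurable_sandwich {C : Ω → Matrix (Fin p) (Fin q) ℝ}
    {A W : Ω → Matrix (Fin p) (Fin p) ℝ} (hC : AEMeasurable C P) (hA : AEMeasurable A P)
    (hW : AEMeasurable W P) : AEMeasurable (fun ω => sandwich (C ω) (A ω) (W ω)) P := by
  have ht := aemeasurable_matrix_mul (aemeasurable_matrix_transpose hC) hW
  have hi := aemeasurable_matrix_inv (aemeasurable_matrix_mul ht hC)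
  exact aemeasurable_matrix_mul (aemeasurable_matrix_mul hi (aemeasurable_matrix_mul
    (aemeasurable_matrix_mul (aemeasurable_matrix_mul ht hA) hW) hC)) hi

theorem aemeasurable_empVar {n : ℕ} {v : ℕ → Ω → Fin p → ℝ}
    (h : ∀ i a, AEMeasurable (fun ω => v i ω a) P) :
    AEMeasurable (fun ω => empVar n fun i => v i ω) P := by
  refine aemeasurable_matrix fun a b => ?_
  simp only [empVar_apply]
  exact (aemeasurable_avg fun i => (h i a).mul (h i b)).sub
    ((aemeasurable_avg fun i => h i a).mul (aemeasurable_avg fun i => h i b))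

theorem aemeasurable_obs_apply (c : Centering) {n : ℕ} {v : ℕ → Ω → Fin p → ℝ}
    (h : ∀ i a, AEMeasurable (fun ω => v i ω a) P) (i : ℕ) (a : Fin p) :
    AEMeasurable (fun ω => (c.obs n fun i => v i ω) i a) P := by
  simp only [obs_apply]
  exact aemeasurable_obs c (fun i => h i a) i

theorem aemeasurable_momentIX {n : ℕ} {I : ℕ → Ω → Fin p → ℝ} {X : ℕ → Ω → Fin q → ℝ}
    (hI : ∀ i a, AEMeasurable (fun ω => I i ω a) P)
    (hX : ∀ i a, AEMeasurable (fun ω => X i ω a) P) :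
    AEMeasurable (fun ω => momentIX n (fun i => I i ω) (fun i => X i ω)) P := by
  refine aemeasurable_matrix fun a b => ?_
  simp only [momentIX_apply]
  exact aemeasurable_avg fun i => (hI i a).mul (hX i b)

theorem aemeasurable_momentVarHat {n n' : ℕ} {I I' : ℕ → Ω → Fin p → ℝ} {Y : ℕ → Ω → ℝ}
    {X' : ℕ → Ω → Fin q → ℝ} {b : Ω → EuclideanSpace ℝ (Fin q)}
    (hI : ∀ i a, AEMeasurable (fun ω => I i ω a) P) (hY : ∀ i, AEMeasurable (Y i) P)
    (hI' : ∀ i a, AEMeasurable (fun ω => I' i ω a) P)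
    (hX' : ∀ i a, AEMeasurable (fun ω => X' i ω a) P) (hb : AEMeasurable b P) :
    AEMeasurable (fun ω => momentVarHat n n' (fun i => I i ω) (fun i => Y i ω)
      (fun i => I' i ω) (fun i => X' i ω) (b ω)) P := by
  have hb' : ∀ a, AEMeasurable (fun ω => (b ω).ofLp a) P := fun a =>
    (Continuous.measurable (f := fun x : EuclideanSpace ℝ (Fin q) => x.ofLp a)
      (by fun_prop)).comp_aemeasurable hb
  have h1 : AEMeasurable (fun ω => empVar n fun i => Y i ω • I i ω) P :=
    aemeasurable_empVar fun i a => (hY i).mul (hI i a)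
  have h2 : AEMeasurable (fun ω => empVar n' fun j => (X' j ω ⬝ᵥ (b ω).ofLp) • I' j ω) P := by
    refine aemeasurable_empVar fun i a => AEMeasurable.mul ?_ (hI' i a)
    simp only [dotProduct]
    exact Finset.aemeasurable_fun_sum _ fun a _ => (hX' i a).mul (hb' a)
  refine aemeasurable_matrix fun a a' => ?_
  have e1 := (measurable_pi_apply a').comp_aemeasurable
    ((measurable_pi_apply a).comp_aemeasurable h1)
  have e2 := (measurable_pi_apply a').comp_aemeasurable
    ((measurable_pi_apply a).comp_aemeasurable h2)
  simp only [momentVarHat, Matrix.add_apply, Matrix.smul_apply, smul_eq_mul]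
  exact (e1.const_mul _).add (e2.const_mul _)

end MatrixMeasurability

/-! ### Asymptotic normality of the sample moment -/

section Normality
variable {m d : ℕ} {S : Type*} [MeasurableSpace S] {μ : Measure S} [IsProbabilityMeasure μ]
  {I I' : S → Fin m → ℝ} {X' : S → Fin d → ℝ} {Y : S → ℝ}
  {Ω : Type*} [MeasurableSpace Ω] {P : Measure Ω} [IsProbabilityMeasure P]
  {Is Is' : ℕ → Ω → Fin m → ℝ} {Ys : ℕ → Ω → ℝ} {Xs' : ℕ → Ω → Fin d → ℝ}
  {n n' : ℕ → ℕ}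

/-- Here `N` is the size of one sample and `N'` the total size. The square of the limit is the
weight `τ⁻¹` in `Ω`. -/
theorem tendsto_sqrt_add_div {N N' : ℕ → ℝ} {τ : ℝ} (hτ : 0 < τ)
    (hN : ∀ k, 0 ≤ N k) (h : Tendsto (fun k => N k / N' k) atTop (𝓝 τ)) :
    Tendsto (fun k => √(N' k) / √(N k)) atTop (𝓝 (√τ)⁻¹) := by
  have h1 := ((Real.continuous_sqrt.tendsto τ).comp h).inv₀ (Real.sqrt_pos.2 hτ).ne'
  refine h1.congr fun k => ?_
  simp only [Function.comp_apply]
  rw [Real.sqrt_div (hN k), inv_div]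

/-- Asymptotic normality of the sample moment at the true parameter. -/
theorem tendstoInDistribution_sampleMoment (c : Centering)
    (hid : ∀ i, IdentDistrib (fun ω => (Is i ω, Ys i ω)) (fun s => (I s, Y s)) P μ)
    (hid' : ∀ j, IdentDistrib (fun ω => (Is' j ω, Xs' j ω)) (fun s => (I' s, X' s)) P μ)
    (hind : iIndepFun (fun i ω => (Is i ω, Ys i ω)) P)
    (hind' : iIndepFun (fun j ω => (Is' j ω, Xs' j ω)) P)
    (hindep : IndepFun (fun ω i => (Is i ω, Ys i ω)) (fun ω j => (Is' j ω, Xs' j ω)) P)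
    (hI : ∀ a, MemLp (fun s => I s a) 4 μ) (hY : MemLp Y 4 μ)
    (hI' : ∀ a, MemLp (fun s => I' s a) 4 μ) (hX' : ∀ b, MemLp (fun s => X' s b) 4 μ)
    (hI0 : ∀ a, ∫ s, I s a ∂μ = 0) (hY0 : ∫ s, Y s ∂μ = 0)
    (hI0' : ∀ a, ∫ s, I' s a ∂μ = 0) (hX0' : ∀ b, ∫ s, X' s b ∂μ = 0)
    (hn : Tendsto n atTop atTop) (hn' : Tendsto n' atTop atTop) {τ τ' : ℝ} (hτ : 0 < τ)
    (hτ' : 0 < τ') (hnτ : Tendsto (fun k => (n k : ℝ) / ((n k : ℝ) + n' k)) atTop (𝓝 τ))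
    (hnτ' : Tendsto (fun k => (n' k : ℝ) / ((n k : ℝ) + n' k)) atTop (𝓝 τ'))
    {β : EuclideanSpace ℝ (Fin d)}
    (hmean : ∀ a, ∫ s, Y s * I s a ∂μ = (crossCov μ I' X' *ᵥ β.ofLp) a) :
    TendstoInDistribution (fun k ω => √((n k : ℝ) + n' k) • WithLp.toLp 2
      (sampleMoment (n k) (n' k) (c.obs (n k) fun i => Is i ω) (c.obs (n k) fun i => Ys i ω)
        (c.obs (n' k) fun j => Is' j ω) (c.obs (n' k) fun j => Xs' j ω) β)) atTop id
      (fun _ => P) (multivariateGaussian 0 (momentVar μ τ τ' I Y I' X' β)) := by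
  have hr := tendsto_sqrt_add_div hτ (fun k => Nat.cast_nonneg (n k)) hnτ
  have hr' := tendsto_sqrt_add_div hτ' (fun k => Nat.cast_nonneg (n' k)) hnτ'
  have hXβ : MemLp (fun s => X' s ⬝ᵥ β.ofLp) 4 μ := memLp_dotProduct hX' _
  have mF : Measurable fun z : (Fin m → ℝ) × ℝ => z.2 • z.1 := by fun_prop
  have mD : Measurable fun z : (Fin m → ℝ) × (Fin d → ℝ) => z.2 ⬝ᵥ β.ofLp := by
    simp only [dotProduct]; fun_prop
  have mG : Measurable fun z : (Fin m → ℝ) × (Fin d → ℝ) => (z.2 ⬝ᵥ β.ofLp) • z.1 :=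
    mD.smul measurable_fst
  have pop := tendstoInDistribution_two_sample hid hind hid' hind' hindep mF mG
    (fun a => memLp_two_mul hY (hI a)) (fun a => memLp_two_mul hXβ (hI' a))
    (fun a => by
      simp only [Pi.smul_apply, smul_eq_mul]
      rw [hmean, integral_dotProduct_mul hI' hX' hI0']) hn hn' hr hr'
  simp only [inv_pow, Real.sq_sqrt hτ.le, Real.sq_sqrt hτ'.le] at pop
  have hXβ0 : ∫ s, X' s ⬝ᵥ β.ofLp ∂μ = 0 := by
    simp only [dotProduct]
    rw [integral_finsetSum _ fun b _ => ((hX' b).integrable (by norm_num)).mul_const _]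
    simp [integral_mul_const, hX0']
  cases c with
  | population =>
    simp only [Centering.obs, sampleMoment, momentIX_mulVec, momentIY]
    exact pop
  | sampleMean =>
    have hIm : ∀ i a, AEMeasurable (fun ω => Is i ω a) P := fun i a =>
      ((measurable_pi_apply a).comp measurable_fst).comp_aemeasurable (hid i).aemeasurable_fst
    have hYm : ∀ i, AEMeasurable (Ys i) P := fun i =>
      measurable_snd.comp_aemeasurable (hid i).aemeasurable_fst
    have hIm' : ∀ i a, AEMeasurable (fun ω => Is' i ω a) P := fun i a =>
      ((measurable_pi_apply a).comp measurable_fst).comp_aemeasurable (hid' i).aemeasurable_fst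
    have hXm' : ∀ i b, AEMeasurable (fun ω => Xs' i ω b) P := fun i b =>
      ((measurable_pi_apply b).comp measurable_snd).comp_aemeasurable (hid' i).aemeasurable_fst
    refine tendstoInDistribution_of_tendstoInMeasure_sub _ _ pop ?_ fun k => ?_
    · refine (tendstoInMeasure_const_iff (c := (0 : EuclideanSpace ℝ (Fin m)))).2 ?_
      -- This is `√N` times the centered minus the uncentered sample moment at `β`: only products of
      -- two sample means remain.
      have key : Tendsto (fun p : ℕ × Ω => fun a : Fin m =>
          √((n p.1 : ℝ) + n' p.1) * ((avg (n' p.1) fun j => Is' j p.2 a) *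
            avg (n' p.1) fun j => Xs' j p.2 ⬝ᵥ β.ofLp) -
          √((n p.1 : ℝ) + n' p.1) * ((avg (n p.1) fun i => Is i p.2 a) *
            avg (n p.1) fun i => Ys i p.2)) (inProb P) (𝓝 0) := by
        refine tendsto_pi_nhds.2 fun a => ?_
        rw [Pi.zero_apply, ← sub_zero (0 : ℝ)]
        refine Tendsto.sub ?_ ?_
        · have h := tendsto_inProb_mul_avg_mul_avg hid' hind' (f := fun z => z.1 a)
            (g := fun z => z.2 ⬝ᵥ β.ofLp) (by fun_prop) mD (memLp_two_of_four (hI' a))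
            (memLp_two_of_four hXβ) (hI0' a) hXβ0 hn' hr'
          exact h
        · have h := tendsto_inProb_mul_avg_mul_avg hid hind (f := fun z => z.1 a)
            (g := fun z => z.2) (by fun_prop) (by fun_prop) (memLp_two_of_four (hI a))
            (memLp_two_of_four hY) (hI0 a) hY0 hn hr
          exact h
      have h1 := ((PiLp.continuous_toLp 2 (fun _ : Fin m => ℝ)).tendsto 0).comp key
      rw [WithLp.toLp_zero] at h1
      refine h1.congr fun p => ?_
      ext a
      have e : (avg (n' p.1) fun j => Xs' j p.2 ⬝ᵥ β.ofLp) =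
          ∑ b, (avg (n' p.1) fun j => Xs' j p.2 b) * β.ofLp b := by
        simp only [dotProduct, avg_sum, avg_mul_const]
      have e2 : (momentIX (n' p.1) (Centering.sampleMean.obs (n' p.1) fun j => Is' j p.2)
          (Centering.sampleMean.obs (n' p.1) fun j => Xs' j p.2) *ᵥ β.ofLp) a =
          (avg (n' p.1) fun j => (Xs' j p.2 ⬝ᵥ β.ofLp) • Is' j p.2) a -
          (avg (n' p.1) fun j => Is' j p.2 a) * avg (n' p.1) fun j => Xs' j p.2 ⬝ᵥ β.ofLp := by
        rw [← momentIX_mulVec, e]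
        simp only [mulVec, dotProduct, momentIX_apply, obs_apply, avg_obs_mul_obs, Finset.mul_sum,
          ← Finset.sum_sub_distrib]
        exact Finset.sum_congr rfl fun b _ => by ring
      simp only [Function.comp_apply, Pi.sub_apply, PiLp.sub_apply, PiLp.smul_apply, sampleMoment,
        e2, momentIY_apply, obs_apply, avg_obs_mul_obs, smul_eq_mul]
      simp only [avg_apply, Pi.smul_apply, smul_eq_mul]
      ring
    · refine AEMeasurable.const_smul (g := fun ω => WithLp.toLp 2 (sampleMoment _ _ _ _ _ _ _)) ?_
        (√((n k : ℝ) + n' k))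
      refine (WithLp.measurable_toLp 2 _).comp_aemeasurable (aemeasurable_pi_lambda _ fun a => ?_)
      simp only [sampleMoment, Pi.sub_apply, momentIY_apply, mulVec, dotProduct, momentIX_apply]
      refine AEMeasurable.sub (aemeasurable_avg fun i => (aemeasurable_obs _ hYm i).mul
        (aemeasurable_obs_apply _ hIm i a)) (Finset.aemeasurable_fun_sum _ fun b _ => ?_)
      exact (aemeasurable_avg fun i => (aemeasurable_obs_apply _ hIm' i a).mul
        (aemeasurable_obs_apply _ hXm' i b)).mul_const _

theorem posSemidef_momentVar (hI : ∀ a, MemLp (fun s => I s a) 4 μ) (hY : MemLp Y 4 μ)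
    (hI' : ∀ a, MemLp (fun s => I' s a) 4 μ) (hX' : ∀ b, MemLp (fun s => X' s b) 4 μ)
    {τ τ' : ℝ} (hτ : 0 < τ) (hτ' : 0 < τ') (β : EuclideanSpace ℝ (Fin d)) :
    (momentVar μ τ τ' I Y I' X' β).PosSemidef :=
  ((posSemidef_varMatrix fun a => memLp_two_mul hY (hI a)).smul (inv_nonneg.2 hτ.le)).add
    ((posSemidef_varMatrix fun a => memLp_two_mul (memLp_dotProduct hX' _) (hI' a)).smul
      (inv_nonneg.2 hτ'.le))

theorem posSemidef_momentVarHat (n n' : ℕ) (I : ℕ → Fin m → ℝ) (Y : ℕ → ℝ)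
    (I' : ℕ → Fin m → ℝ) (X' : ℕ → Fin d → ℝ) (β : EuclideanSpace ℝ (Fin d)) :
    (momentVarHat n n' I Y I' X' β).PosSemidef :=
  ((posSemidef_empVar _ _).smul (by positivity)).add ((posSemidef_empVar _ _).smul (by positivity))

end Normality

/-! ### From the sample moment to the estimator; studentization -/

section Estimator
variable {m d : ℕ} {Ω : Type*} [MeasurableSpace Ω] {P : Measure Ω}

/-- The studentizing matrices converge in probability. -/
theorem tendsto_invSqrt_sandwich {C : ℕ → Ω → Matrix (Fin m) (Fin d) ℝ}
    {A : ℕ → Ω → Matrix (Fin m) (Fin m) ℝ} {C₀ : Matrix (Fin m) (Fin d) ℝ}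
    {A₀ : Matrix (Fin m) (Fin m) ℝ}
    (hC : Tendsto (fun p : ℕ × Ω => C p.1 p.2) (inProb P) (𝓝 C₀))
    (hA : Tendsto (fun p : ℕ × Ω => A p.1 p.2) (inProb P) (𝓝 A₀))
    (hpsd : ∀ k ω, (A k ω).PosSemidef) (hA₀ : A₀.PosDef) (hdet : (C₀ᵀ * A₀⁻¹ * C₀).det ≠ 0) :
    Tendsto (fun p : ℕ × Ω => invSqrt (sandwich (C p.1 p.2) (A p.1 p.2) (A p.1 p.2)⁻¹)) (inProb P)
      (𝓝 (invSqrt (sandwich C₀ A₀ A₀⁻¹))) := by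
  have hdetA := hA₀.det_pos.ne'
  have hAi := tendsto_matrix_inv hA hdetA
  have hV := tendsto_sandwich hC hA hAi hdet
  have hcont := continuousOn_invSqrt (d := d) _ (posDef_sandwich_inv hA₀ hdet)
  -- Continuity is available only within the positive definite matrices. The estimated matrices lie
  -- there with probability tending to one: `A` is always positive semidefinite, so nonzero
  -- determinants suffice.
  refine hcont.tendsto.comp (tendsto_nhdsWithin_iff.2 ⟨hV, ?_⟩)
  filter_upwards [(tendsto_matrix_det hA).eventually_ne hdetA,
    (tendsto_matrix_det (tendsto_gram hC hAi)).eventually_ne hdet] with p h1 h2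
  exact posDef_sandwich_inv ((hpsd _ _).posDef_iff_det_ne_zero.2 h1) h2

theorem eventually_posDef_of_tendsto_one [IsProbabilityMeasure P]
    {W : ℕ → Ω → Matrix (Fin m) (Fin m) ℝ}
    (hWm : ∀ k, AEMeasurable (W k) P)
    (hWpos : Tendsto (fun k => P {ω | (W k ω).PosDef}) atTop (𝓝 1)) :
    ∀ᶠ p in inProb P, (W p.1 p.2).PosDef :=
  eventually_inProb_of_tendsto_one (s := fun k => {ω | (W k ω).PosDef})
    (fun k => (hWm k).nullMeasurable measurableSet_posDef) hWpos

variable {C : ℕ → Ω → Matrix (Fin m) (Fin d) ℝ}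
  {C₀ : Matrix (Fin m) (Fin d) ℝ} {W : ℕ → Ω → Matrix (Fin m) (Fin m) ℝ}
  {W₀ : Matrix (Fin m) (Fin m) ℝ} {g : ℕ → Ω → Fin m → ℝ}
  {b : ℕ → Ω → EuclideanSpace ℝ (Fin d)} {β : EuclideanSpace ℝ (Fin d)}

theorem tendstoInMeasure_of_sub_eq_gmmMatrix
    (hC : Tendsto (fun p : ℕ × Ω => C p.1 p.2) (inProb P) (𝓝 C₀))
    (hW : Tendsto (fun p : ℕ × Ω => W p.1 p.2) (inProb P) (𝓝 W₀))
    (hdet : (C₀ᵀ * W₀ * C₀).det ≠ 0)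
    (hg : Tendsto (fun p : ℕ × Ω => g p.1 p.2) (inProb P) (𝓝 0))
    (hrep : ∀ᶠ p in inProb P,
      (b p.1 p.2 - β).ofLp = gmmMatrix (C p.1 p.2) (W p.1 p.2) *ᵥ g p.1 p.2) :
    TendstoInMeasure P b atTop (fun _ => β) := by
  rw [tendstoInMeasure_const_iff]
  have h1 := ((continuous_fst.matrix_mulVec continuous_snd).tendsto
    (gmmMatrix C₀ W₀, (0 : Fin m → ℝ))).comp ((tendsto_gmmMatrix hC hW hdet).prodMk_nhds hg)
  have h2 := ((PiLp.continuous_toLp 2 (fun _ : Fin d => ℝ)).tendsto _).comp h1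
  simp only [mulVec_zero, WithLp.toLp_zero] at h2
  have h3 := h2.add_const β
  rw [zero_add] at h3
  refine h3.congr' ?_
  filter_upwards [hrep] with p hp
  simp only [Function.comp_apply]
  rw [← hp]
  simp

theorem tendstoInDistribution_of_sub_eq_gmmMatrix [IsProbabilityMeasure P] {r : ℕ → ℝ}
    {A : Matrix (Fin m) (Fin m) ℝ} (hA : A.PosSemidef)
    (hC : Tendsto (fun p : ℕ × Ω => C p.1 p.2) (inProb P) (𝓝 C₀))
    (hCm : ∀ k, AEMeasurable (C k) P)
    (hW : Tendsto (fun p : ℕ × Ω => W p.1 p.2) (inProb P) (𝓝 W₀))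
    (hWm : ∀ k, AEMeasurable (W k) P) (hW₀ : W₀.PosDef)
    (hdet : (C₀ᵀ * W₀ * C₀).det ≠ 0)
    (hg : TendstoInDistribution (fun k ω => r k • WithLp.toLp 2 (g k ω)) atTop id (fun _ => P)
      (multivariateGaussian 0 A))
    (hb : ∀ k, AEMeasurable (b k) P)
    (hrep : ∀ᶠ p in inProb P,
      (b p.1 p.2 - β).ofLp = gmmMatrix (C p.1 p.2) (W p.1 p.2) *ᵥ g p.1 p.2) :
    TendstoInDistribution (fun k ω => r k • (b k ω - β)) atTop id (fun _ => P)
      (multivariateGaussian 0 (sandwich C₀ A W₀)) := by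
  have h1 := tendstoInDistribution_mulVec (M := fun k ω => gmmMatrix (C k ω) (W k ω)) hA hg
    (tendsto_gmmMatrix hC hW hdet) (fun k => aemeasurable_gmmMatrix (hCm k) (hWm k))
  rw [← sandwich_eq (PosDef.transpose_eq hW₀)] at h1
  refine tendstoInDistribution_of_eventually_eq h1
    (fun k => ((hb k).sub_const β).const_smul (r k)) ?_
  filter_upwards [hrep] with p hp
  rw [WithLp.ofLp_smul, mulVec_smul, WithLp.toLp_smul, ← hp, WithLp.toLp_ofLp]

/-- Slutsky's theorem with the random matrix `V̂^(-1/2)`: the limiting covariance is `V^(-1/2) V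
V^(-1/2) = 1`. -/
theorem tendstoInDistribution_studentized [IsProbabilityMeasure P] {r : ℕ → ℝ}
    {A : ℕ → Ω → Matrix (Fin m) (Fin m) ℝ}
    {A₀ : Matrix (Fin m) (Fin m) ℝ} (hA₀ : A₀.PosDef)
    (hC : Tendsto (fun p : ℕ × Ω => C p.1 p.2) (inProb P) (𝓝 C₀))
    (hCm : ∀ k, AEMeasurable (C k) P)
    (hA : Tendsto (fun p : ℕ × Ω => A p.1 p.2) (inProb P) (𝓝 A₀))
    (hAm : ∀ k, AEMeasurable (A k) P) (hpsd : ∀ k ω, (A k ω).PosSemidef)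
    (hdet : (C₀ᵀ * A₀⁻¹ * C₀).det ≠ 0)
    (hb : TendstoInDistribution (fun k ω => r k • (b k ω - β)) atTop id (fun _ => P)
      (multivariateGaussian 0 (sandwich C₀ A₀ A₀⁻¹))) :
    TendstoInDistribution (fun k ω => r k • Matrix.toEuclideanCLM (𝕜 := ℝ)
      (invSqrt (sandwich (C k ω) (A k ω) (A k ω)⁻¹)) (b k ω - β)) atTop id (fun _ => P)
      (multivariateGaussian 0 1) := by
  have hV := posDef_sandwich_inv hA₀ hdet
  have h1 := tendstoInDistribution_mulVec
    (M := fun k ω => invSqrt (sandwich (C k ω) (A k ω) (A k ω)⁻¹)) hV.posSemidef hb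
    (tendsto_invSqrt_sandwich hC hA hpsd hA₀ hdet)
    (fun k => measurable_invSqrt.comp_aemeasurable (aemeasurable_sandwich (hCm k)
        (hAm k) (aemeasurable_matrix_inv (hAm k))))
  rw [invSqrt_mul_mul_invSqrt hV] at h1
  convert! h1 using 3 with k ω
  rw [← map_smul]
  rfl

end Estimator
end UnpairedIV
end

/-! ### The main theorem -/

theorem mainTheorem9 {m d : ℕ}
    -- population
    {S : Type*} [MeasurableSpace S] (μ : Measure S) [IsProbabilityMeasure μ]
    (I It : S → Fin m → ℝ) (X Xt : S → Fin d → ℝ) (Y ε : S → ℝ)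
    (β : EuclideanSpace ℝ (Fin d))
    (hI : Measurable I)
    (hY : ∀ᵐ s ∂μ, Y s = X s ⬝ᵥ β.ofLp + ε s)
    -- finite fourth moments
    (hI4 : ∀ a, MemLp (fun s => I s a) 4 μ) (hX4 : ∀ b, MemLp (fun s => X s b) 4 μ)
    (hY4 : MemLp Y 4 μ)
    (hIt4 : ∀ a, MemLp (fun s => It s a) 4 μ) (hXt4 : ∀ b, MemLp (fun s => Xt s b) 4 μ)
    -- all variables are centered
    (hI0 : ∀ a, ∫ s, I s a ∂μ = 0) (hX0 : ∀ b, ∫ s, X s b ∂μ = 0) (hY0 : ∫ s, Y s ∂μ = 0)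
    (hIt0 : ∀ a, ∫ s, It s a ∂μ = 0) (hXt0 : ∀ b, ∫ s, Xt s b ∂μ = 0)
    -- equal cross-covariances, exogeneity, full rank
    (hcov : UnpairedIV.crossCov μ It Xt = UnpairedIV.crossCov μ I X)
    (hexo : μ[ε | MeasurableSpace.comap I inferInstance] =ᵐ[μ] 0)
    (hrank : (UnpairedIV.crossCov μ I X).rank = d)
    -- two independent i.i.d. samples, of sizes `n k` and `nt k`
    {P₀ : Type*} [MeasurableSpace P₀] (P : Measure P₀) [IsProbabilityMeasure P]
    (Is : ℕ → P₀ → Fin m → ℝ) (Ys : ℕ → P₀ → ℝ)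
    (Its : ℕ → P₀ → Fin m → ℝ) (Xts : ℕ → P₀ → Fin d → ℝ)
    (hid : ∀ i, IdentDistrib (fun ω => (Is i ω, Ys i ω)) (fun s => (I s, Y s)) P μ)
    (hidt : ∀ j, IdentDistrib (fun ω => (Its j ω, Xts j ω)) (fun s => (It s, Xt s)) P μ)
    (hindep : iIndepFun (fun i ω => (Is i ω, Ys i ω)) P)
    (hindept : iIndepFun (fun j ω => (Its j ω, Xts j ω)) P)
    (hindep2 : IndepFun (fun ω i => (Is i ω, Ys i ω)) (fun ω j => (Its j ω, Xts j ω)) P)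
    (n nt : ℕ → ℕ) (hn : Tendsto n atTop atTop) (hnt : Tendsto nt atTop atTop)
    (τ τt : ℝ) (hτ : τ ∈ Set.Ioo (0 : ℝ) 1) (hτt : τt ∈ Set.Ioo (0 : ℝ) 1)
    (hnτ : Tendsto (fun k => (n k : ℝ) / ((n k : ℝ) + nt k)) atTop (𝓝 τ))
    (hntτ : Tendsto (fun k => (nt k : ℝ) / ((n k : ℝ) + nt k)) atTop (𝓝 τt))
    -- weight matrices, converging in probability to a positive definite matrix
    (W : ℕ → P₀ → Matrix (Fin m) (Fin m) ℝ) (W0 : Matrix (Fin m) (Fin m) ℝ)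
    (hWm : ∀ k a b, AEMeasurable (fun ω => W k ω a b) P)
    (hWpos : Tendsto (fun k => P {ω | (W k ω).PosDef}) atTop (𝓝 1))
    (hW0 : W0.PosDef)
    (hW : ∀ a b, TendstoInMeasure P (fun k ω => W k ω a b) atTop (fun _ => W0 a b))
    -- the estimator, from the data as they are or from data centered by their sample means
    (c : UnpairedIV.Centering)
    (βhat : ℕ → P₀ → EuclideanSpace ℝ (Fin d))
    (hβm : ∀ k, AEMeasurable (βhat k) P)
    (hβ : ∀ k, ∀ᵐ ω ∂P, (W k ω).PosDef →
      UnpairedIV.IsGMM (W k ω) (n k) (nt k)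
        (c.obs (n k) fun i => Is i ω) (c.obs (n k) fun i => Ys i ω)
        (c.obs (nt k) fun j => Its j ω) (c.obs (nt k) fun j => Xts j ω) (βhat k ω)) :
    let Ω := UnpairedIV.momentVar μ τ τt I Y It Xt β
    let V := fun W' => UnpairedIV.sandwich (UnpairedIV.crossCov μ It Xt) Ω W'
    TendstoInMeasure P βhat atTop (fun _ => β) ∧
    -- asymptotic normality
    TendstoInDistribution (fun k ω => √((n k : ℝ) + nt k) • (βhat k ω - β)) atTop id
      (fun _ => P) (multivariateGaussian 0 (V W0)) ∧
    -- `W0 = Ω⁻¹` minimizes the asymptotic variance in the Loewner order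
    (Ω.PosDef → ∀ W' : Matrix (Fin m) (Fin m) ℝ, W'.PosDef → (V W' - V Ω⁻¹).PosSemidef) ∧
    -- for `W0 = Ω⁻¹`, the studentized estimator is asymptotically standard normal
    (Ω.PosDef → W0 = Ω⁻¹ →
      ∀ β₀ : ℕ → P₀ → EuclideanSpace ℝ (Fin d), (∀ k, AEMeasurable (β₀ k) P) →
        TendstoInMeasure P β₀ atTop (fun _ => β) →
        TendstoInDistribution
          (fun k ω => √((n k : ℝ) + nt k) •
            Matrix.toEuclideanCLM (𝕜 := ℝ) (UnpairedIV.invSqrt (UnpairedIV.asymVarHat (n k) (nt k)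
              (c.obs (n k) fun i => Is i ω) (c.obs (n k) fun i => Ys i ω)
              (c.obs (nt k) fun j => Its j ω) (c.obs (nt k) fun j => Xts j ω) (β₀ k ω)))
              (βhat k ω - β))
          atTop id (fun _ => P) (multivariateGaussian 0 1)) := by
  intro Ω V
  have hτ0 := hτ.1
  have hτt0 := hτt.1
  have hIm : ∀ i a, AEMeasurable (fun ω => Is i ω a) P := fun i a =>
    ((measurable_pi_apply a).comp measurable_fst).comp_aemeasurable (hid i).aemeasurable_fst
  have hYm : ∀ i, AEMeasurable (Ys i) P := fun i =>
    measurable_snd.comp_aemeasurable (hid i).aemeasurable_fst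
  have hItm : ∀ i a, AEMeasurable (fun ω => Its i ω a) P := fun i a =>
    ((measurable_pi_apply a).comp measurable_fst).comp_aemeasurable (hidt i).aemeasurable_fst
  have hXtm : ∀ i b, AEMeasurable (fun ω => Xts i ω b) P := fun i b =>
    ((measurable_pi_apply b).comp measurable_snd).comp_aemeasurable (hidt i).aemeasurable_fst
  set C := UnpairedIV.crossCov μ It Xt with hCdef
  have hrankC : C.rank = d := by rw [hcov]; exact hrank
  have hCinj := UnpairedIV.mulVec_injective_of_rank hrankC
  -- The two samples are linked only here: the moment condition involves `Cov(I, X)`, while the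
  -- second sample estimates `Cov(Ĩ, X̃)`.
  have hmean : ∀ a, ∫ s, Y s * I s a ∂μ = (C *ᵥ β.ofLp) a := by
    intro a
    rw [hcov]
    exact UnpairedIV.integral_mul_eq_crossCov_mulVec hI hY hI4 hX4 hY4 hI0 hexo a
  have hΩ : Ω.PosSemidef := UnpairedIV.posSemidef_momentVar hI4 hY4 hIt4 hXt4 hτ0 hτt0 β
  -- limits in probability
  let Chat : ℕ → P₀ → Matrix (Fin m) (Fin d) ℝ := fun k ω =>
    UnpairedIV.momentIX (nt k) (c.obs (nt k) fun j => Its j ω) (c.obs (nt k) fun j => Xts j ω)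
  let g : ℕ → P₀ → Fin m → ℝ := fun k ω =>
    UnpairedIV.sampleMoment (n k) (nt k) (c.obs (n k) fun i => Is i ω) (c.obs (n k) fun i => Ys i ω)
      (c.obs (nt k) fun j => Its j ω) (c.obs (nt k) fun j => Xts j ω) β
  have hC : Tendsto (fun p : ℕ × P₀ => Chat p.1 p.2) (UnpairedIV.inProb P) (𝓝 C) :=
    UnpairedIV.tendsto_momentIX c hidt hindept hIt4 hXt4 hIt0 hXt0 hnt
  have hW' : Tendsto (fun p : ℕ × P₀ => W p.1 p.2) (UnpairedIV.inProb P) (𝓝 W0) :=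
    tendsto_pi_nhds.2 fun a => tendsto_pi_nhds.2 fun b => by
      have h := hW a b
      rwa [UnpairedIV.tendstoInMeasure_const_iff] at h
  have hg : Tendsto (fun p : ℕ × P₀ => g p.1 p.2) (UnpairedIV.inProb P) (𝓝 0) := by
    have h1 := UnpairedIV.tendsto_momentIY c hid hindep hI4 hY4 hI0 hY0 hn
    have h2 := (Continuous.matrix_mulVec continuous_id
      (continuous_const (y := β.ofLp))).tendsto C |>.comp hC
    have h3 := h1.sub h2
    have e : (fun a => ∫ s, Y s * I s a ∂μ) - id C *ᵥ β.ofLp = 0 := by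
      ext a
      simp [hmean]
    rw [e] at h3
    exact h3
  have hdet : (Cᵀ * W0 * C).det ≠ 0 := (UnpairedIV.posDef_gram hCinj hW0).det_pos.ne'
  have hWm' := fun k => UnpairedIV.aemeasurable_matrix (hWm k)
  have hCm := fun k =>
    UnpairedIV.aemeasurable_momentIX (n := nt k) (P := P)
      (I := fun i ω => (c.obs (nt k) fun j => Its j ω) i)
      (X := fun i ω => (c.obs (nt k) fun j => Xts j ω) i)
      (UnpairedIV.aemeasurable_obs_apply c hItm) (UnpairedIV.aemeasurable_obs_apply c hXtm)
  -- the estimation error is a linear function of the sample moment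
  have hrep : ∀ᶠ p in UnpairedIV.inProb P, (βhat p.1 p.2 - β).ofLp =
      UnpairedIV.gmmMatrix (Chat p.1 p.2) (W p.1 p.2) *ᵥ g p.1 p.2 := by
    filter_upwards [UnpairedIV.eventually_posDef_of_tendsto_one hWm' hWpos,
      UnpairedIV.eventually_inProb_of_ae hβ,
      -- The limiting Gram matrix is invertible, so the sample one is invertible with probability
      -- tending to one.
      (UnpairedIV.tendsto_matrix_det (UnpairedIV.tendsto_gram hC hW')).eventually_ne hdet]
      with p h1 h2 h3
    exact (h2 h1).sub_eq h1 h3 β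
  have hclt := UnpairedIV.tendstoInDistribution_sampleMoment c hid hidt hindep hindept hindep2
    hI4 hY4 hIt4 hXt4 hI0 hY0 hIt0 hXt0 hn hnt hτ0 hτt0 hnτ hntτ hmean
  have hnormal := UnpairedIV.tendstoInDistribution_of_sub_eq_gmmMatrix hΩ hC hCm hW' hWm' hW0 hdet
    hclt hβm hrep
  refine ⟨UnpairedIV.tendstoInMeasure_of_sub_eq_gmmMatrix hC hW' hdet hg hrep, hnormal,
    fun hpd W' hW' => UnpairedIV.posSemidef_sandwich_sub hrankC hpd hW', ?_⟩
  intro hpd hW0Ω β₀ hβ₀m hβ₀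
  rw [UnpairedIV.tendstoInMeasure_const_iff] at hβ₀
  rw [hW0Ω] at hnormal hdet
  have hA : Tendsto (fun p : ℕ × P₀ => UnpairedIV.momentVarHat (n p.1) (nt p.1)
      (c.obs (n p.1) fun i => Is i p.2) (c.obs (n p.1) fun i => Ys i p.2)
      (c.obs (nt p.1) fun j => Its j p.2) (c.obs (nt p.1) fun j => Xts j p.2) (β₀ p.1 p.2))
      (UnpairedIV.inProb P) (𝓝 Ω) := by
    have t1 := (hnτ.inv₀ hτ0.ne').comp (UnpairedIV.tendsto_fst_inProb (P := P))
    have t2 := (hntτ.inv₀ hτt0.ne').comp (UnpairedIV.tendsto_fst_inProb (P := P))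
    exact (t1.smul (UnpairedIV.tendsto_empVar_smul c hid hindep hI4 hY4 hI0 hY0 hn)).add
      (t2.smul (UnpairedIV.tendsto_empVar_dotProduct_smul c hidt hindept hIt4 hXt4 hIt0 hXt0 hnt
        hβ₀))
  have hAm := fun k =>
    UnpairedIV.aemeasurable_momentVarHat (n := n k) (n' := nt k)
      (I := fun i ω => (c.obs (n k) fun j => Is j ω) i)
      (Y := fun i ω => (c.obs (n k) fun j => Ys j ω) i)
      (I' := fun i ω => (c.obs (nt k) fun j => Its j ω) i)
      (X' := fun i ω => (c.obs (nt k) fun j => Xts j ω) i)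
      (UnpairedIV.aemeasurable_obs_apply c hIm) (UnpairedIV.aemeasurable_obs c hYm)
      (UnpairedIV.aemeasurable_obs_apply c hItm) (UnpairedIV.aemeasurable_obs_apply c hXtm)
      (hβ₀m k)
  exact UnpairedIV.tendstoInDistribution_studentized hpd hC hCm hA hAm
    (fun k ω => UnpairedIV.posSemidef_momentVarHat _ _ _ _ _ _ _) hdet hnormal
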